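/- Let $N\ge 2$, $s\in(0,1)$, $m>0$, $2^*_s=\frac{2N}{N-2s}$, and let $g:\mathbb R\to\mathbb R$ satisfy - (g0) $g$ is continuous and $g(0)=0$; - (g1) $\limsup_{t\to0}\frac{g(t)}{t}\le 0$; - (g2) $\limsup_{|t|\to+\infty}\frac{|g(t)|}{|t|^{2^*_s-1}}<\infty$. Set $G(t)=\int_0^t g(\tau)\,d\tau$ and let $H^s(\mathbb R^N)=\{u\in L^2(\mathbb R^N)\mid |\cdot|^s\mathcal F(u)\in L^2(\mathbb R^N)\}$ (real-valued functions). For $u\in H^s(\mathbb R^N)$ and $\mu\in\mathbb R$ define, with values in $\mathbb R\cup\{+\infty\}$ (where $\int_{\mathbb R^N} G(u)\,dx\in[-\infty,+\infty)$), $$K(u)=\tfrac12\int_{\mathbb R^N}|(-\Delta)^{s/2}u|^2dx-\int_{\mathbb R^N}G(u)\,dx,\qquad J_\mu(u)=K(u)+\tfrac{\mu}{2}\int_{\mathbb R^N}u^2dx,$$ $$P_\mu(u)=\int_{\mathbb R^N}|(-\Delta)^{s/2}u|^2dx+2^*_s\int_{\mathbb R^N}\Big(\tfrac{\mu}{2}u^2-G(u)\Big)dx,$$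 and let $$\mathcal S_m=\Big\{u\in H^s(\mathbb R^N)\;\Big|\;\int_{\mathbb R^N}u^2dx=m\Big\},\qquad \mathcal P_\mu=\{u\in H^s(\mathbb R^N)\setminus\{0\}\mid P_\mu(u)=0\}.$$ An $L^2$-minimum is a function $u\in\mathcal S_m$ with $K(u)=\inf_{\mathcal S_m}K$; it has Lagrange multiplier $\mu\in\mathbb R$ if $u$ is a weak solution of $(-\Delta)^su+\mu u=g(u)$ in $\mathbb R^N$, i.e. $$\int_{\mathbb R^N}(-\Delta)^{s/2}u\,(-\Delta)^{s/2}\varphi\,dx+\mu\int_{\mathbb R^N}u\varphi\,dx=\int_{\mathbb R^N}g(u)\varphi\,dx\qquad\text{for all }\varphi\in H^s(\mathbb R^N)\cap L^1(\mathbb R^N).$$ Then the following hold. (i) If $u$ is an $L^2$-minimum with Lagrange multiplier $\mu\in\mathbb R$, then $u\in\mathcal P_\mu$, $J_\mu(u)=\inf_{\mathcal P_\mu}J_\mu$, and $$\inf_{\mathcal S_m}K=\inf_{\mathcal P_\mu}J_\mu-\frac{\mu}{2}m.$$ (ii) Let $\mu\in\mathbb R$ be the Lagrange multiplier of some $L^2$-minimum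 $v\in\mathcal S_m$. If $u\in\mathcal P_\mu$ satisfies $J_\mu(u)=\inf_{\mathcal P_\mu}J_\mu$, then $u\in\mathcal S_m$ and $K(u)=\inf_{\mathcal S_m}K$. -/

import Mathlib

open MeasureTheory Filter Topology
open scoped ENNReal FourierTransform

noncomputable section

namespace FracNLS

/-- The Euclidean space `ℝ^N`. -/
abbrev RN (N : ℕ) : Type := EuclideanSpace ℝ (Fin N)

/-- The real space `L²(ℝ^N)`. -/
abbrev L2 (N : ℕ) : Type := Lp ℝ 2 (volume : Measure (RN N))

/-- The complex space `L²(ℝ^N; ℂ)`. -/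
abbrev L2C (N : ℕ) : Type := Lp ℂ 2 (volume : Measure (RN N))

/-- A real `L²` function regarded as a complex one. -/
def complexify (N : ℕ) : L2 N →L[ℝ] L2C N :=
  Complex.ofRealCLM.compLpL 2 (volume : Measure (RN N))

/-- The function `ξ ↦ |ξ|^s 𝓕(u)(ξ)`. As `𝓕` is normalised with kernel `exp(-2πi⟨x, ξ⟩)`,
the frequency variable is `2πξ`, so that the symbol of `(-Δ)^(s/2)` is `(2π|ξ|)^s`. -/
def symbolMul {N : ℕ} (s : ℝ) (u : L2 N) : RN N → ℂ :=
  fun ξ => ((2 * Real.pi * ‖ξ‖) ^ s : ℝ) • (𝓕 (complexify N u) : L2C N) ξ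

lemma symbolMul_add {N : ℕ} (s : ℝ) (u v : L2 N) :
    symbolMul s (u + v) =ᵐ[volume] symbolMul s u + symbolMul s v := by
  have h : (𝓕 (complexify N (u + v)) : L2C N) = 𝓕 (complexify N u) + 𝓕 (complexify N v) := by
    rw [map_add, FourierTransform.fourier_add]
  filter_upwards [Lp.coeFn_add (𝓕 (complexify N u) : L2C N) (𝓕 (complexify N v))] with ξ hξ
  simp only [symbolMul, Pi.add_apply, h, hξ, smul_add]

lemma symbolMul_smul {N : ℕ} (s c : ℝ) (u : L2 N) :
    symbolMul s (c • u) =ᵐ[volume] c • symbolMul s u := by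
  have h : (𝓕 (complexify N (c • u)) : L2C N) = (c : ℂ) • 𝓕 (complexify N u) := by
    rw [map_smul, ← FourierTransform.fourier_smul]
    congr 1
  filter_upwards [Lp.coeFn_smul (c : ℂ) (𝓕 (complexify N u) : L2C N)] with ξ hξ
  simp only [symbolMul, Pi.smul_apply, h, hξ, Complex.real_smul, smul_eq_mul]
  ring

lemma symbolMul_zero {N : ℕ} (s : ℝ) : symbolMul s (0 : L2 N) =ᵐ[volume] 0 := by
  simpa using symbolMul_smul s 0 (0 : L2 N)

/-- The fractional Sobolev space `H^s(ℝ^N)` of real-valued functions: all `u ∈ L²(ℝ^N)` such that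
`|·|^s 𝓕(u) ∈ L²(ℝ^N)`. -/
def Hs (N : ℕ) (s : ℝ) : Submodule ℝ (L2 N) where
  carrier := {u | MemLp (symbolMul s u) 2 volume}
  add_mem' := fun {u v} hu hv => (memLp_congr_ae (symbolMul_add s u v)).2 (hu.add hv)
  zero_mem' := (memLp_congr_ae (symbolMul_zero s)).2 MemLp.zero
  smul_mem' := fun c u hu => (memLp_congr_ae (symbolMul_smul s c u)).2 (hu.const_smul c)

variable {N : ℕ} {s : ℝ}

/-- `(-Δ)^(s/2) u = 𝓕⁻¹(|ξ|^s 𝓕(u))`, as an element of `L²`. -/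
def halfLap (u : Hs N s) : L2C N := 𝓕⁻ (MemLp.toLp (symbolMul s (u : L2 N)) u.2)

/-- The Dirichlet energy `∫ |(-Δ)^(s/2) u|² dx`. -/
def energy (u : Hs N s) : ℝ := ∫ x, ‖halfLap u x‖ ^ 2

/-- The form `∫ (-Δ)^(s/2) u (-Δ)^(s/2) φ dx`. Both factors are real-valued for real `u` and `φ`;
conjugating one of them and taking the real part only reflects that they are elements
of the complex `L²`. -/
def energyForm (u φ : Hs N s) : ℝ :=
  ∫ x, (halfLap u x * (starRingEnd ℂ) (halfLap φ x)).re

/-- The mass `|u|₂² = ∫ u² dx`. -/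
def mass (u : Hs N s) : ℝ := ∫ x, ((u : L2 N) x) ^ 2

/-- The integral `∫ f dx ∈ [-∞, +∞]`: the integral of the positive part minus the integral of the
negative part. (If both are infinite, the value is `⊥` by convention; for `f = G(u)` with
`u ∈ H^s` and `g` as below, the integral of the positive part is always finite.) -/
def extIntegral (f : RN N → ℝ) : EReal :=
  ((∫⁻ x, ENNReal.ofReal (f x) : ℝ≥0∞) : EReal) - ((∫⁻ x, ENNReal.ofReal (-f x) : ℝ≥0∞) : EReal)

/-- The primitive `G(t) = ∫₀ᵗ g(τ) dτ`. -/
def primitive (g : ℝ → ℝ) (t : ℝ) : ℝ := ∫ τ in (0 : ℝ)..t, g τ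

/-- `∫ G(u) dx ∈ [-∞, +∞]`. -/
def potential (g : ℝ → ℝ) (u : Hs N s) : EReal :=
  extIntegral (fun x => primitive g ((u : L2 N) x))

/-- The fractional critical Sobolev exponent `2^*_s = 2N / (N - 2s)`. -/
def critExp (N : ℕ) (s : ℝ) : ℝ := 2 * N / (N - 2 * s)

/-- The assumptions on the nonlinearity: `g` is continuous and `g(0) = 0`;
`limsup_{t → 0} g(t)/t ≤ 0`; `limsup_{|t| → ∞} |g(t)| / |t|^(2^*_s - 1) < ∞`. -/
structure IsAdmissible (N : ℕ) (s : ℝ) (g : ℝ → ℝ) : Prop where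
  continuous : Continuous g
  map_zero : g 0 = 0
  limsup_zero : limsup (fun t : ℝ => ((g t / t : ℝ) : EReal)) (𝓝[≠] 0) ≤ 0
  limsup_infty :
    limsup (fun t : ℝ => ((|g t| / |t| ^ (critExp N s - 1) : ℝ) : EReal)) (atBot ⊔ atTop) < ⊤

/-- The energy functional `K(u) = ½ ∫ |(-Δ)^(s/2) u|² - ∫ G(u)`. -/
def K (g : ℝ → ℝ) (u : Hs N s) : EReal :=
  ((1 / 2 * energy u : ℝ) : EReal) - potential g u

/-- The action functional `J_μ(u) = ½ ∫ |(-Δ)^(s/2) u|² + μ/2 ∫ u² - ∫ G(u)`. -/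
def J (g : ℝ → ℝ) (μ : ℝ) (u : Hs N s) : EReal :=
  ((1 / 2 * energy u + μ / 2 * mass u : ℝ) : EReal) - potential g u

/-- The Pohožaev functional `P_μ(u) = ∫ |(-Δ)^(s/2) u|² + 2^*_s (μ/2 ∫ u² - ∫ G(u))`. -/
def P (g : ℝ → ℝ) (μ : ℝ) (u : Hs N s) : EReal :=
  ((energy u : ℝ) : EReal)
    + ((critExp N s : ℝ) : EReal) * (((μ / 2 * mass u : ℝ) : EReal) - potential g u)

/-- The Pohožaev set `𝓟_μ`. -/
def pohozaevSet (N : ℕ) (s : ℝ) (g : ℝ → ℝ) (μ : ℝ) : Set (Hs N s) :=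
  {u | u ≠ 0 ∧ P g μ u = 0}

/-- The `L²`-sphere `𝓢_m`. -/
def sphere (N : ℕ) (s m : ℝ) : Set (Hs N s) := {u | mass u = m}

/-- `u` is a weak solution of `(-Δ)^s u + μ u = g(u)` in `ℝ^N`, tested against all
`φ ∈ H^s ∩ L¹`. -/
def IsWeakSolution (g : ℝ → ℝ) (μ : ℝ) (u : Hs N s) : Prop :=
  ∀ φ : Hs N s, Integrable ((φ : L2 N) : RN N → ℝ) volume →
    energyForm u φ + μ * ∫ x, (u : L2 N) x * (φ : L2 N) x
      = ∫ x, g ((u : L2 N) x) * (φ : L2 N) x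

/-- `u` is an `L²`-minimum: `u ∈ 𝓢_m` and `K(u) = inf_{𝓢_m} K`. -/
def IsL2Min (g : ℝ → ℝ) (m : ℝ) (u : Hs N s) : Prop :=
  u ∈ sphere N s m ∧ K g u = ⨅ v ∈ sphere N s m, K g v

/-- `u` is an `L²`-minimum with Lagrange multiplier `μ`. -/
def IsL2MinWithMultiplier (g : ℝ → ℝ) (m μ : ℝ) (u : Hs N s) : Prop :=
  IsL2Min g m u ∧ IsWeakSolution g μ u

/-- `u` minimizes `J_μ` on the Pohožaev set: `u ∈ 𝓟_μ` and `J_μ(u) = inf_{𝓟_μ} J_μ`. -/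
def IsActionMin (g : ℝ → ℝ) (μ : ℝ) (u : Hs N s) : Prop :=
  u ∈ pohozaevSet N s g μ ∧ J g μ u = ⨅ v ∈ pohozaevSet N s g μ, J g μ v

end FracNLS

end

open FracNLS

noncomputable section

namespace FracNLS

/-! ### Dilations on L² and their Fourier transforms -/

section Dilation
variable {N : ℕ} {F : Type*} [NormedAddCommGroup F]

/-! Everything rests on the dilations `u(c ·)`. They multiply the energy by `c^(2s-N)`, and both the
mass and `∫ G(u)` by `c^(-N)`. Hence every nonzero function can be brought to mass `m`, with
explicit control of the functionals.

Pohožaev identity (`pohozaev_of_isL2MinWithMultiplier`). Let `u` be an L²-minimum and `φ` a Schwartz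
function with `∫ uφ ≠ 0`. Dilate `u + tφ` back to mass `m`: `K` along this curve is minimal at `t =
0`. Its derivative there, combined with the weak equation tested with `φ`, is a nonzero multiple of
`(∫ uφ) P_μ(u)`, so `P_μ(u) = 0`. Neither regularity of `u` nor integrability of `g(u)u` is needed.

Comparison (`exists_mem_sphere_le_of_pohozaev`). Let `v ∈ 𝓟_μ` have energy `E`, let `w` be its
dilation to mass `m`, and put `α = (N-2s)/N`, `r = m / mass v`. Then `K(w) + μm/2 = (E/2)(r^α - αr)`
and `J_μ(v) = (E/2)(1 - α)`. By concavity of `r ↦ r^α` the former is at most the latter, strictly so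
if `r ≠ 1`. The inequality gives (i), and its strict form forces mass `m` in (ii).

The analytic input is the embedding of `H^s` in `L^(2^*_s)`. It makes the positive part of `G(u)`
integrable and dominates the difference quotients of `∫ G(u + tφ)`. -/

lemma map_smul_volume {c : ℝ} (hc : 0 < c) :
    Measure.map (fun x : RN N => c • x) volume = ENNReal.ofReal ((c ^ N)⁻¹) • volume := by
  rw [Measure.map_addHaar_smul volume hc.ne', finrank_euclideanSpace_fin, abs_of_pos (by positivity)]

lemma quasiMeasurePreserving_smul_pos {c : ℝ} (hc : 0 < c) :
    Measure.QuasiMeasurePreserving (fun x : RN N => c • x) volume volume := by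
  refine ⟨measurable_const_smul c, ?_⟩
  rw [map_smul_volume hc]
  exact Measure.smul_absolutelyContinuous

lemma eLpNorm_comp_smul {f : RN N → F} {p : ℝ≥0∞} {c : ℝ} (hc : 0 < c) (hp : p ≠ ∞)
    (hf : AEStronglyMeasurable f volume) :
    eLpNorm (fun x => f (c • x)) p volume
      = ENNReal.ofReal ((c ^ N)⁻¹) ^ (1 / p).toReal • eLpNorm f p volume := by
  have h := eLpNorm_map_measure (p := p) (μ := volume) (f := fun x : RN N => c • x) (g := f)
    (by rw [map_smul_volume hc]; exact hf.mono_ac Measure.smul_absolutelyContinuous)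
    (measurable_const_smul c).aemeasurable
  rw [map_smul_volume hc, eLpNorm_smul_measure_of_ne_top hp] at h
  exact h.symm

lemma MemLp.comp_smul_pos {f : RN N → F} {p : ℝ≥0∞} {c : ℝ} (hc : 0 < c) (hp : p ≠ ∞)
    (hf : MemLp f p volume) : MemLp (fun x => f (c • x)) p volume := by
  refine ⟨hf.1.comp_quasiMeasurePreserving (quasiMeasurePreserving_smul_pos hc), ?_⟩
  rw [eLpNorm_comp_smul hc hp hf.1, smul_eq_mul]
  exact ENNReal.mul_lt_top (ENNReal.rpow_lt_top_of_nonneg (by positivity) (by simp)) hf.2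

variable [NormedSpace ℝ F]

/-- The dilation `f ↦ f(c ·)` on `L²`. -/
def dilL2 (F : Type*) [NormedAddCommGroup F] [NormedSpace ℝ F] {c : ℝ} (hc : 0 < c) :
    Lp F 2 (volume : Measure (RN N)) →L[ℝ] Lp F 2 (volume : Measure (RN N)) :=
  LinearMap.mkContinuous
    { toFun := fun f => (MemLp.comp_smul_pos hc (by simp) (Lp.memLp f)).toLp
      map_add' := fun f g => by
        rw [← MemLp.toLp_add]
        refine (MemLp.toLp_eq_toLp_iff _ _).2 ?_
        exact (quasiMeasurePreserving_smul_pos hc).ae_eq_comp (Lp.coeFn_add f g)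
      map_smul' := fun a f => by
        rw [RingHom.id_apply, ← MemLp.toLp_const_smul]
        refine (MemLp.toLp_eq_toLp_iff _ _).2 ?_
        exact (quasiMeasurePreserving_smul_pos hc).ae_eq_comp (Lp.coeFn_smul a f) }
    (ENNReal.ofReal ((c ^ N)⁻¹) ^ (1 / (2 : ℝ≥0∞)).toReal).toReal (fun f => by
      refine le_of_eq ((Lp.norm_toLp (fun x => f (c • x))
        (MemLp.comp_smul_pos hc (by simp) (Lp.memLp f))).trans ?_)
      rw [eLpNorm_comp_smul hc (by simp) (Lp.aestronglyMeasurable f), Lp.norm_def,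
        smul_eq_mul, ENNReal.toReal_mul])

lemma coeFn_dilL2 {c : ℝ} (hc : 0 < c) (f : Lp F 2 (volume : Measure (RN N))) :
    dilL2 F hc f =ᵐ[volume] fun x => f (c • x) :=
  MemLp.coeFn_toLp (MemLp.comp_smul_pos hc (by simp) (Lp.memLp f))

lemma ae_comp_smul {α : Type*} {f g : RN N → α} {c : ℝ} (hc : 0 < c) (h : f =ᵐ[volume] g) :
    (fun x => f (c • x)) =ᵐ[volume] fun x => g (c • x) :=
  (quasiMeasurePreserving_smul_pos hc).ae_eq_comp h

lemma fourier_comp_smul (f : RN N → ℂ) {c : ℝ} (hc : 0 < c) (ξ : RN N) :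
    𝓕 (fun x => f (c • x)) ξ = ((c ^ N)⁻¹ : ℝ) • 𝓕 f (c⁻¹ • ξ) := by
  rw [Real.fourier_eq, Real.fourier_eq]
  have := Measure.integral_comp_smul_of_nonneg (volume : Measure (RN N))
    (fun v => Real.fourierChar (-(inner ℝ v (c⁻¹ • ξ))) • f v) c (hR := hc.le)
  rw [finrank_euclideanSpace_fin] at this
  rw [← this]
  congr 1
  ext v
  rw [inner_smul_left, inner_smul_right]
  simp [hc.ne']

/-- Both sides are continuous in `f`, so it suffices to treat Schwartz functions, where the
transform is an integral and the change of variables applies. -/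
lemma fourier_dilL2 {c : ℝ} (hc : 0 < c) (f : L2C N) :
    (𝓕 (dilL2 ℂ hc f) : L2C N) = ((c ^ N)⁻¹ : ℝ) • dilL2 ℂ (inv_pos.2 hc) (𝓕 f) := by
  refine DenseRange.induction_on (p := fun f : L2C N => (𝓕 (dilL2 ℂ hc f) : L2C N)
      = ((c ^ N)⁻¹ : ℝ) • dilL2 ℂ (inv_pos.2 hc) (𝓕 f))
    (SchwartzMap.denseRange_toLpCLM (p := 2) (μ := (volume : Measure (RN N))) (F := ℂ)
      ENNReal.ofNat_ne_top) f ?_ ?_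
  · refine isClosed_eq ?_ ?_
    · exact (Lp.fourierTransformₗᵢ (RN N) ℂ).continuous.comp (dilL2 ℂ hc).continuous
    · exact (((c ^ N)⁻¹ : ℝ) • dilL2 ℂ (inv_pos.2 hc)).continuous.comp
        (Lp.fourierTransformₗᵢ (RN N) ℂ).continuous
  · intro φ
    let e : RN N ≃L[ℝ] RN N := ContinuousLinearEquiv.smulLeft (Units.mk0 c hc.ne')
    let ψ : SchwartzMap (RN N) ℂ := SchwartzMap.compCLMOfContinuousLinearEquiv ℝ e φ
    have hψ : ∀ x, ψ x = φ (c • x) := fun x => rfl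
    rw [SchwartzMap.toLpCLM_apply]
    have h1 : dilL2 ℂ hc (φ.toLp 2 : L2C N) = ψ.toLp 2 := by
      refine Lp.ext ?_
      filter_upwards [coeFn_dilL2 hc (φ.toLp 2 : L2C N), SchwartzMap.coeFn_toLp ψ 2,
        ae_comp_smul hc (SchwartzMap.coeFn_toLp φ 2)] with x a1 a2 a3
      rw [a1, a2, a3, hψ]
    rw [h1, SchwartzMap.toLp_fourier_eq, SchwartzMap.toLp_fourier_eq]
    have h2 := SchwartzMap.coeFn_toLp (𝓕 φ) 2 (volume : Measure (RN N))
    refine Lp.ext ?_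
    filter_upwards [Lp.coeFn_smul ((c ^ N)⁻¹ : ℝ)
        (dilL2 ℂ (inv_pos.2 hc) ((𝓕 φ).toLp 2 (volume : Measure (RN N)))),
      coeFn_dilL2 (inv_pos.2 hc) ((𝓕 φ).toLp 2 (volume : Measure (RN N))),
      ae_comp_smul (inv_pos.2 hc) h2,
      SchwartzMap.coeFn_toLp (𝓕 ψ) 2 (volume : Measure (RN N))] with ξ a1 a2 a3 a4
    rw [a4, a1, Pi.smul_apply, a2, a3, SchwartzMap.fourier_coe, SchwartzMap.fourier_coe,
      ← fourier_comp_smul _ hc]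
    rfl

end Dilation

/-! ### Scaling and positivity of energy and mass on H^s -/

variable {N : ℕ} {s : ℝ}

lemma coeFn_complexify (u : L2 N) : complexify N u =ᵐ[volume] fun x => (u x : ℂ) :=
  ContinuousLinearMap.coeFn_compLpL _ _

lemma complexify_dilL2 {c : ℝ} (hc : 0 < c) (u : L2 N) :
    complexify N (dilL2 ℝ hc u) = dilL2 ℂ hc (complexify N u) := by
  refine Lp.ext ?_
  filter_upwards [coeFn_complexify (dilL2 ℝ hc u), coeFn_dilL2 hc u,
    coeFn_dilL2 hc (complexify N u), ae_comp_smul hc (coeFn_complexify u)] with x a1 a2 a3 a4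
  rw [a1, a2, a3, a4]

/-- The factor `c^(-N)` is the Jacobian of the Fourier transform; `c^s` comes from the homogeneity
of the symbol. -/
lemma symbolMul_dilL2 {c : ℝ} (hc : 0 < c) (u : L2 N) :
    symbolMul s (dilL2 ℝ hc u) =ᵐ[volume]
      fun ξ => ((c ^ N)⁻¹ * c ^ s : ℝ) • symbolMul s u (c⁻¹ • ξ) := by
  have h := fourier_dilL2 hc (complexify N u)
  rw [← complexify_dilL2] at h
  filter_upwards [Lp.coeFn_smul ((c ^ N)⁻¹ : ℝ) (dilL2 ℂ (inv_pos.2 hc) (𝓕 (complexify N u))),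
    coeFn_dilL2 (inv_pos.2 hc) (𝓕 (complexify N u))] with ξ a1 a2
  rw [symbolMul, h, a1, Pi.smul_apply, a2, symbolMul, norm_smul, smul_smul, smul_smul]
  congr 1
  have : 2 * Real.pi * ‖ξ‖ = c * (2 * Real.pi * (‖c⁻¹‖ * ‖ξ‖)) := by
    rw [Real.norm_of_nonneg (by positivity)]
    field_simp
  rw [this, Real.mul_rpow hc.le (by positivity)]
  ring

/-- The dilation `u ↦ u(c ·)` on `H^s`. -/
def dil {c : ℝ} (hc : 0 < c) (u : Hs N s) : Hs N s :=
  ⟨dilL2 ℝ hc u, (memLp_congr_ae (symbolMul_dilL2 hc (u : L2 N))).2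
    ((MemLp.comp_smul_pos (inv_pos.2 hc) (by simp) u.2).const_smul ((c ^ N)⁻¹ * c ^ s : ℝ))⟩

lemma coeFn_dil {c : ℝ} (hc : 0 < c) (u : Hs N s) :
    ((dil hc u : Hs N s) : L2 N) =ᵐ[volume] fun x => (u : L2 N) (c • x) :=
  coeFn_dilL2 hc (u : L2 N)

lemma integral_norm_sq_fourierInv (f : L2C N) :
    ∫ x, ‖(𝓕⁻ f : L2C N) x‖ ^ 2 = ∫ x, ‖f x‖ ^ 2 := by
  have h : ∀ f : L2C N, ∫ x, ‖f x‖ ^ 2 = ‖f‖ ^ 2 := fun f => by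
    rw [← @inner_self_eq_norm_sq ℂ, L2.inner_def, ← integral_re]
    · simp [inner_self_eq_norm_sq_to_K, ← Complex.ofReal_pow]
    · exact L2.integrable_inner f f
  rw [h, h]
  congr 1
  exact (Lp.fourierTransformₗᵢ (RN N) ℂ).symm.norm_map f

lemma energy_eq (u : Hs N s) : energy u = ∫ ξ, ‖symbolMul s (u : L2 N) ξ‖ ^ 2 := by
  rw [energy, halfLap, integral_norm_sq_fourierInv]
  refine integral_congr_ae ?_
  filter_upwards [MemLp.coeFn_toLp u.2] with ξ h
  rw [h]

lemma energy_nonneg (u : Hs N s) : 0 ≤ energy u := integral_nonneg fun _ => by positivity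

lemma integral_comp_smul_pos {c : ℝ} (hc : 0 < c) (f : RN N → ℝ) :
    ∫ x, f (c • x) = (c ^ N)⁻¹ * ∫ x, f x := by
  rw [Measure.integral_comp_smul_of_nonneg volume f c (hR := hc.le), finrank_euclideanSpace_fin,
    smul_eq_mul]

lemma energy_dil {c : ℝ} (hc : 0 < c) (u : Hs N s) :
    energy (dil hc u) = c ^ (2 * s - N) * energy u := by
  rw [energy_eq, energy_eq]
  have h : ∫ ξ, ‖symbolMul s (dil hc u : L2 N) ξ‖ ^ 2
      = ∫ ξ, ((c ^ N)⁻¹ * c ^ s : ℝ) ^ 2 * ‖symbolMul s (u : L2 N) (c⁻¹ • ξ)‖ ^ 2 := by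
    refine integral_congr_ae ?_
    filter_upwards [symbolMul_dilL2 (s := s) hc (u : L2 N)] with ξ h
    change ‖symbolMul s (dilL2 ℝ hc (u : L2 N)) ξ‖ ^ 2 = _
    rw [h, norm_smul, mul_pow, Real.norm_of_nonneg (by positivity)]
  rw [h, integral_const_mul, integral_comp_smul_pos (inv_pos.2 hc)
    (fun ξ => ‖symbolMul s (u : L2 N) ξ‖ ^ 2), ← mul_assoc]
  congr 1
  rw [Real.rpow_sub hc, two_mul, Real.rpow_add hc, Real.rpow_natCast, inv_pow,
    inv_inv]
  field_simp

lemma mass_dil {c : ℝ} (hc : 0 < c) (u : Hs N s) : mass (dil hc u) = (c ^ N)⁻¹ * mass u := by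
  rw [mass, mass, ← integral_comp_smul_pos hc (fun x => ((u : L2 N) x) ^ 2)]
  refine integral_congr_ae ?_
  filter_upwards [coeFn_dil hc u] with x h
  rw [h]

lemma integrable_sq (u : L2 N) : Integrable (fun x => u x ^ 2) volume := (Lp.memLp u).integrable_sq

lemma mass_eq_zero_iff (u : Hs N s) : mass u = 0 ↔ u = 0 := by
  rw [mass, integral_eq_zero_iff_of_nonneg (fun _ => sq_nonneg _) (integrable_sq _)]
  constructor
  · intro h
    refine Subtype.ext (Lp.ext ?_)
    filter_upwards [h, Lp.coeFn_zero ℝ 2 (volume : Measure (RN N))] with x h1 h2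
    rw [ZeroMemClass.coe_zero, h2]
    simpa using h1
  · rintro rfl
    filter_upwards [Lp.coeFn_zero ℝ 2 (volume : Measure (RN N))] with x h2
    rw [ZeroMemClass.coe_zero, h2]
    simp

lemma mass_nonneg (u : Hs N s) : 0 ≤ mass u := integral_nonneg fun _ => sq_nonneg _

lemma mass_pos {u : Hs N s} (hu : u ≠ 0) : 0 < mass u :=
  (mass_nonneg u).lt_of_ne' (mt (mass_eq_zero_iff u).1 hu)

lemma complexify_injective : Function.Injective (complexify N) := by
  intro u v h
  refine Lp.ext ?_
  filter_upwards [coeFn_complexify u, coeFn_complexify v] with x a b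
  rw [h, b] at a
  exact_mod_cast a.symm

/-- The symbol is nonzero away from the origin, which is a null set because `N ≠ 0`. Zero energy
therefore kills the Fourier transform, which is injective. -/
lemma energy_pos (hN : N ≠ 0) {u : Hs N s} (hu : u ≠ 0) : 0 < energy u := by
  refine (energy_nonneg u).lt_of_ne' fun h => hu ?_
  have : Nonempty (Fin N) := ⟨⟨0, Nat.pos_of_ne_zero hN⟩⟩
  rw [energy_eq, integral_eq_zero_iff_of_nonneg (fun _ => by positivity)
    (u.2.integrable_norm_pow (by simp))] at h
  have h0 : (𝓕 (complexify N (u : L2 N)) : L2C N) = 0 := by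
    refine Lp.ext ?_
    filter_upwards [h, Lp.coeFn_zero ℂ 2 (volume : Measure (RN N)),
      Measure.ae_ne volume (0 : RN N)] with ξ h1 h2 h3
    rw [h2]
    have h4 : 0 < (2 * Real.pi * ‖ξ‖) ^ s := by
      have := norm_pos_iff.2 h3
      positivity
    simpa [symbolMul, h4.ne'] using h1
  have h1 : complexify N (u : L2 N) = 0 := by
    have := (Lp.fourierTransformₗᵢ (RN N) ℂ).map_eq_zero_iff.1 h0
    exact this
  refine Subtype.ext (complexify_injective ?_)
  rw [h1, ZeroMemClass.coe_zero, map_zero]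

/-! ### Energy and mass as quadratic forms -/

lemma memLp_symbolMul (u : Hs N s) : MemLp (symbolMul s (u : L2 N)) 2 volume := u.2

lemma halfLap_eq (u : Hs N s) : halfLap u = 𝓕⁻ (MemLp.toLp _ (memLp_symbolMul u)) := rfl

lemma halfLap_add (u v : Hs N s) : halfLap (u + v) = halfLap u + halfLap v := by
  rw [halfLap_eq, halfLap_eq, halfLap_eq, ← FourierTransform.fourierInv_add, ← MemLp.toLp_add]
  congr 1
  exact (MemLp.toLp_eq_toLp_iff _ _).2 (symbolMul_add s (u : L2 N) v)

lemma halfLap_smul (t : ℝ) (u : Hs N s) : halfLap (t • u) = t • halfLap u := by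
  have h : MemLp.toLp _ (memLp_symbolMul (t • u))
      = (t : ℂ) • MemLp.toLp _ (memLp_symbolMul u) := by
    have h' : ((t : ℂ) • MemLp.toLp _ (memLp_symbolMul u) : L2C N)
        = t • MemLp.toLp _ (memLp_symbolMul u) := (RCLike.real_smul_eq_coe_smul _ _).symm
    rw [h', ← MemLp.toLp_const_smul]
    exact (MemLp.toLp_eq_toLp_iff _ _).2 (symbolMul_smul s t (u : L2 N))
  rw [halfLap_eq, h, FourierTransform.fourierInv_smul]
  exact (RCLike.real_smul_eq_coe_smul (K := ℂ) t (halfLap u)).symm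

lemma energy_eq_norm_sq (u : Hs N s) : energy u = ‖halfLap u‖ ^ 2 := by
  rw [← @inner_self_eq_norm_sq ℂ, L2.inner_def, ← integral_re (L2.integrable_inner _ _), energy]
  simp [inner_self_eq_norm_sq_to_K, ← Complex.ofReal_pow]

lemma energyForm_eq_inner (u φ : Hs N s) :
    energyForm u φ = RCLike.re (inner ℂ (halfLap φ) (halfLap u)) := by
  rw [L2.inner_def, ← integral_re (L2.integrable_inner _ _), energyForm]
  rfl

lemma energy_add_smul (u φ : Hs N s) (t : ℝ) :
    energy (u + t • φ) = energy u + 2 * t * energyForm u φ + t ^ 2 * energy φ := by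
  rw [energy_eq_norm_sq, energy_eq_norm_sq, energy_eq_norm_sq, halfLap_add, halfLap_smul,
    energyForm_eq_inner, @norm_add_sq ℂ, norm_smul, mul_pow, Real.norm_eq_abs, sq_abs,
    RCLike.real_smul_eq_coe_smul (K := ℂ), inner_smul_right, RCLike.re_ofReal_mul, inner_re_symm]
  ring

lemma mass_add_smul (u φ : Hs N s) (t : ℝ) :
    mass (u + t • φ) = mass u + 2 * t * (∫ x, (u : L2 N) x * (φ : L2 N) x) + t ^ 2 * mass φ := by
  have hi : Integrable (fun x => (u : L2 N) x * (φ : L2 N) x) volume :=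
    (Lp.memLp (u : L2 N)).integrable_mul (Lp.memLp (φ : L2 N))
  have h : mass (u + t • φ) = ∫ x, (((u : L2 N) x) ^ 2
      + 2 * t * ((u : L2 N) x * (φ : L2 N) x)) + t ^ 2 * ((φ : L2 N) x) ^ 2 := by
    refine integral_congr_ae ?_
    filter_upwards [Lp.coeFn_add (u : L2 N) (t • (φ : L2 N)), Lp.coeFn_smul t (φ : L2 N)]
      with x h1 h2
    rw [Submodule.coe_add, Submodule.coe_smul, h1, Pi.add_apply, h2, Pi.smul_apply, smul_eq_mul]
    ring
  have h12 : Integrable (fun x => ((u : L2 N) x) ^ 2 + 2 * t * ((u : L2 N) x * (φ : L2 N) x))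
      volume := (integrable_sq _).add (hi.const_mul _)
  rw [h, integral_add h12 ((integrable_sq _).const_mul _),
    integral_add (integrable_sq _) (hi.const_mul _), integral_const_mul, integral_const_mul]
  rfl

/-! ### Schwartz functions as directions in H^s -/

lemma memLp_rpow_smul_schwartz (hs0 : 0 ≤ s) (hs1 : s ≤ 1) (ψ : SchwartzMap (RN N) ℂ) :
    MemLp (fun ξ : RN N => ((2 * Real.pi * ‖ξ‖) ^ s : ℝ) • ψ ξ) 2 volume := by
  have hm : AEStronglyMeasurable (fun ξ : RN N => ((2 * Real.pi * ‖ξ‖) ^ s : ℝ) • ψ ξ) volume := by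
    refine Continuous.aestronglyMeasurable ?_
    exact ((continuous_const.mul continuous_norm).rpow_const (fun _ => Or.inr hs0)).smul ψ.continuous
  rw [memLp_two_iff_integrable_sq_norm hm]
  obtain ⟨M, hM⟩ : ∃ M, ∀ ξ, ‖ψ ξ‖ ≤ M :=
    ⟨_, fun ξ => ψ.toBoundedContinuousFunction.norm_coe_le_norm ξ⟩
  have h0 := ψ.integrable_pow_mul (volume : Measure (RN N)) 0
  have h2 := ψ.integrable_pow_mul (volume : Measure (RN N)) 2
  refine ((h0.const_mul M).add (h2.const_mul (M * (2 * Real.pi) ^ 2))).mono' (hm.norm.pow 2) ?_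
  refine ae_of_all _ fun ξ => ?_
  have hr : 0 ≤ 2 * Real.pi * ‖ξ‖ := by positivity
  have h3 : ((2 * Real.pi * ‖ξ‖) ^ s) ^ 2 ≤ 1 + (2 * Real.pi * ‖ξ‖) ^ 2 := by
    rcases le_total (2 * Real.pi * ‖ξ‖) 1 with h | h
    · have := Real.rpow_le_one hr h hs0
      have h' := Real.rpow_nonneg hr s
      nlinarith [sq_nonneg (2 * Real.pi * ‖ξ‖)]
    · have := Real.rpow_le_rpow_of_exponent_le h hs1
      rw [Real.rpow_one] at this
      have h' := Real.rpow_nonneg hr s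
      nlinarith
  rw [Real.norm_of_nonneg (by positivity), norm_smul, mul_pow, Real.norm_of_nonneg (by positivity)]
  calc ((2 * Real.pi * ‖ξ‖) ^ s) ^ 2 * ‖ψ ξ‖ ^ 2
      ≤ (1 + (2 * Real.pi * ‖ξ‖) ^ 2) * (M * ‖ψ ξ‖) := by
        gcongr
        rw [sq]
        gcongr
        exact hM ξ
    _ = _ := by simp only [Pi.add_apply]; ring

/-- A real Schwartz function as an element of `H^s`. -/
def schwartzHs (hs0 : 0 ≤ s) (hs1 : s ≤ 1) (φ : SchwartzMap (RN N) ℝ) : Hs N s :=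
  ⟨φ.toLp 2, by
    let ψ : SchwartzMap (RN N) ℂ := SchwartzMap.postcompCLM Complex.ofRealCLM φ
    have h : complexify N (φ.toLp 2) = ψ.toLp 2 := by
      refine Lp.ext ?_
      filter_upwards [coeFn_complexify (φ.toLp 2 : L2 N), SchwartzMap.coeFn_toLp ψ 2,
        SchwartzMap.coeFn_toLp φ 2 (volume : Measure (RN N))] with x h1 h2 h3
      rw [h1, h2, h3]
      rfl
    refine (memLp_congr_ae ?_).2 (memLp_rpow_smul_schwartz hs0 hs1 (𝓕 ψ))
    have h' : (𝓕 (complexify N (φ.toLp 2)) : L2C N) = (𝓕 ψ).toLp 2 := by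
      rw [h, SchwartzMap.toLp_fourier_eq]
    filter_upwards [SchwartzMap.coeFn_toLp (𝓕 ψ) 2 (volume : Measure (RN N))] with ξ h2
    rw [symbolMul, h', h2]⟩

lemma coeFn_schwartzHs (hs0 : 0 ≤ s) (hs1 : s ≤ 1) (φ : SchwartzMap (RN N) ℝ) :
    (schwartzHs hs0 hs1 φ : L2 N) =ᵐ[volume] φ :=
  SchwartzMap.coeFn_toLp φ 2 (volume : Measure (RN N))

lemma exists_schwartz_integral_ne_zero {u : Hs N s} (hu : u ≠ 0) :
    ∃ φ : SchwartzMap (RN N) ℝ, ∫ x, (u : L2 N) x * φ x ≠ 0 := by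
  by_contra! H
  refine hu (Subtype.ext (Lp.ext ?_))
  have hl : LocallyIntegrable (u : L2 N) volume :=
    (Lp.memLp (u : L2 N)).locallyIntegrable (by norm_num)
  filter_upwards [ae_eq_zero_of_integral_contDiff_smul_eq_zero hl (fun g h1 h2 => by
      simpa [mul_comm] using H (h2.toSchwartzMap h1)),
    Lp.coeFn_zero ℝ 2 (volume : Measure (RN N))] with x h1 h2
  rw [h1, ZeroMemClass.coe_zero, h2]
  rfl

/-! ### The fractional Sobolev embedding -/

lemma continuous_fourierInv_of_integrable {w : RN N → ℂ} (hw : Integrable w volume) :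
    Continuous (𝓕⁻ w) := by
  have h : (𝓕⁻ w) = fun x => 𝓕 w (-x) := by
    ext x
    rw [Real.fourierInv_eq_fourier_neg]
  rw [h]
  exact (VectorFourier.fourierIntegral_continuous Real.continuous_fourierChar
    continuous_inner hw).comp continuous_neg

lemma norm_fourierInv_le_integral_norm (w : RN N → ℂ) (x : RN N) : ‖𝓕⁻ w x‖ ≤ ∫ ξ, ‖w ξ‖ := by
  rw [Real.fourierInv_eq_fourier_neg]
  exact VectorFourier.norm_fourierIntegral_le_integral_norm _ _ _ _ _

lemma integral_fourierInv_mul {w : RN N → ℂ} (hw : Integrable w volume)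
    (φ : SchwartzMap (RN N) ℂ) : ∫ ξ, 𝓕⁻ φ ξ * w ξ = ∫ x, φ x * 𝓕⁻ w x := by
  -- This duality concerns the forward transform; replacing `w` by its reflection turns it into the
  -- one for the inverse transform.
  have h := VectorFourier.integral_fourierIntegral_smul_eq_flip (L := innerₗ (RN N))
    (μ := volume) (ν := volume) Real.continuous_fourierChar continuous_inner
    φ.integrable (hw.comp_neg)
  rw [← integral_neg_eq_self]
  have e1 : ∀ ξ, 𝓕⁻ φ (-ξ) * w (-ξ) = VectorFourier.fourierIntegral Real.fourierChar volume
      (innerₗ (RN N)) φ ξ • w (-ξ) := fun ξ => by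
    rw [SchwartzMap.fourierInv_coe, Real.fourierInv_eq_fourier_neg, neg_neg]
    rfl
  simp_rw [e1]
  rw [h]
  congr 1
  ext x
  rw [flip_innerₗ, Real.fourierInv_eq_fourier_comp_neg]
  rfl

/-- The inverse transform on `L²` and the one given by an integral have the same pairings with test
functions. The identification makes the sup bound by the `L¹` norm available for the low-frequency
part of an `L²` function. -/
lemma coeFn_fourierInv_of_integrable (w : L2C N) (hw : Integrable w volume) :
    (𝓕⁻ w : L2C N) =ᵐ[volume] 𝓕⁻ (w : RN N → ℂ) := by
  refine ae_eq_of_integral_contDiff_smul_eq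
    ((Lp.memLp (𝓕⁻ w : L2C N)).locallyIntegrable (by norm_num))
    (continuous_fourierInv_of_integrable hw).locallyIntegrable fun g hg hc => ?_
  let φ : SchwartzMap (RN N) ℂ :=
    SchwartzMap.postcompCLM Complex.ofRealCLM (hc.toSchwartzMap hg)
  have h1 : ∫ x, φ x * (𝓕⁻ w : L2C N) x = ∫ x, φ x * 𝓕⁻ (w : RN N → ℂ) x := by
    rw [← integral_fourierInv_mul hw φ]
    have h := congrArg (fun T : TemperedDistribution (RN N) ℂ => T φ)
      (Lp.fourierInv_toTemperedDistribution_eq w)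
    simp only [TemperedDistribution.fourierInv_apply, Lp.toTemperedDistribution_apply,
      smul_eq_mul] at h
    exact h.symm
  exact h1

/-- Low frequencies: an `L²` bound on `|ξ|^s F` bounds the `L¹` norm of `F` on balls. -/
lemma exists_lintegral_ball_le (hN : 1 ≤ N) (hs : 2 * s < N) {F : RN N → ℂ} (hF : Measurable F)
    (hsF : ∫⁻ ξ, ENNReal.ofReal (‖ξ‖ ^ (2 * s) * ‖F ξ‖ ^ 2) < ∞) :
    ∃ C : ℝ, 0 < C ∧ ∀ A : ℝ, 0 < A →
      ∫⁻ ξ in Metric.ball 0 A, ‖F ξ‖ₑ ≤ ENNReal.ofReal (C * A ^ ((N : ℝ) / 2 - s)) := by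
  have hfin : ∀ A : ℝ, IntegrableOn (fun ξ : RN N => ‖ξ‖ ^ (-(2 * s))) (Metric.ball 0 A) volume := by
    intro A
    refine integrableOn_ball_of_norm_le_rpow (C := 1) (by simpa using hN) (by simpa using hs) ?_ ?_
    · refine ae_of_all _ fun ξ => ?_
      rw [one_mul, Real.norm_of_nonneg (by positivity)]
    · exact (measurable_norm.pow_const _).aestronglyMeasurable
  set κ : ℝ := ∫ ξ in Metric.ball (0 : RN N) 1, ‖ξ‖ ^ (-(2 * s)) with hκ
  have hκ0 : 0 ≤ κ := integral_nonneg fun _ => by positivity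
  have hscale : ∀ A : ℝ, 0 < A → ∫ ξ in Metric.ball (0 : RN N) A, ‖ξ‖ ^ (-(2 * s))
      = A ^ ((N : ℝ) - 2 * s) * κ := by
    intro A hA
    have h := Measure.setIntegral_comp_smul_of_pos (volume : Measure (RN N))
      (fun ξ : RN N => ‖ξ‖ ^ (-(2 * s))) (Metric.ball 0 1) hA
    rw [smul_unitBall_of_pos hA, finrank_euclideanSpace_fin, smul_eq_mul] at h
    have h2 : ∀ ξ : RN N, ‖A • ξ‖ ^ (-(2 * s)) = A ^ (-(2 * s)) * ‖ξ‖ ^ (-(2 * s)) := fun ξ => by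
      rw [norm_smul, Real.norm_of_nonneg hA.le, Real.mul_rpow hA.le (norm_nonneg _)]
    simp_rw [h2] at h
    rw [integral_const_mul, ← hκ] at h
    rw [sub_eq_add_neg, Real.rpow_add hA, Real.rpow_natCast, mul_assoc, h]
    field_simp
  set E : ℝ≥0∞ := ∫⁻ ξ, ENNReal.ofReal (‖ξ‖ ^ (2 * s) * ‖F ξ‖ ^ 2) with hE
  -- Cauchy–Schwarz for `|ξ|^(-s) · |ξ|^s |F|` on the ball: the first factor contributes `(κ
  -- A^(N-2s))^(1/2)`, the second at most `E^(1/2)`. The `+ 1` only keeps the constant positive.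
  refine ⟨κ ^ (1 / 2 : ℝ) * E.toReal ^ (1 / 2 : ℝ) + 1, by positivity, fun A hA => ?_⟩
  have hHolder := ENNReal.lintegral_mul_le_Lp_mul_Lq
    (volume.restrict (Metric.ball (0 : RN N) A)) Real.HolderConjugate.two_two
    (f := fun ξ : RN N => ENNReal.ofReal (‖ξ‖ ^ (-s))) (g := fun ξ : RN N => ENNReal.ofReal (‖ξ‖ ^ s * ‖F ξ‖))
    (by fun_prop) (by fun_prop)
  have e0 : ∫⁻ ξ in Metric.ball 0 A, ‖F ξ‖ₑ = ∫⁻ ξ in Metric.ball (0 : RN N) A,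
      ((fun ξ : RN N => ENNReal.ofReal (‖ξ‖ ^ (-s))) * (fun ξ : RN N => ENNReal.ofReal (‖ξ‖ ^ s * ‖F ξ‖))) ξ := by
    have : Nonempty (Fin N) := ⟨⟨0, hN⟩⟩
    refine lintegral_congr_ae (ae_restrict_of_ae ?_)
    filter_upwards [Measure.ae_ne volume (0 : RN N)] with ξ hξ
    have := norm_pos_iff.2 hξ
    rw [Pi.mul_apply, ← ENNReal.ofReal_mul (by positivity), ← mul_assoc, ← Real.rpow_add this]
    simp
  have e1 : ∫⁻ ξ in Metric.ball (0 : RN N) A, ENNReal.ofReal (‖ξ‖ ^ (-s)) ^ (2 : ℝ)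
      = ENNReal.ofReal (A ^ ((N : ℝ) - 2 * s) * κ) := by
    rw [← hscale A hA, ofReal_integral_eq_lintegral_ofReal (hfin A)
      (ae_of_all _ fun _ => by positivity)]
    refine lintegral_congr fun ξ => ?_
    rw [ENNReal.ofReal_rpow_of_nonneg (by positivity) (by norm_num),
      ← Real.rpow_mul (norm_nonneg _)]
    congr 2
    ring
  have e2 : ∫⁻ ξ in Metric.ball (0 : RN N) A, ENNReal.ofReal (‖ξ‖ ^ s * ‖F ξ‖) ^ (2 : ℝ)
      ≤ ENNReal.ofReal E.toReal := by
    rw [ENNReal.ofReal_toReal hsF.ne]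
    refine (setLIntegral_le_lintegral _ _).trans (le_of_eq (lintegral_congr fun ξ => ?_))
    rw [ENNReal.ofReal_rpow_of_nonneg (by positivity) (by norm_num), Real.mul_rpow (by positivity)
      (by positivity), ← Real.rpow_mul (norm_nonneg _), Real.rpow_two, mul_comm s]
  rw [e0]
  refine hHolder.trans ?_
  rw [e1]
  refine (mul_le_mul_right (ENNReal.rpow_le_rpow e2 (by norm_num)) _).trans ?_
  rw [ENNReal.ofReal_rpow_of_nonneg (by positivity) (by norm_num),
    ENNReal.ofReal_rpow_of_nonneg (by positivity) (by norm_num), ← ENNReal.ofReal_mul (by positivity)]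
  refine ENNReal.ofReal_le_ofReal ?_
  rw [Real.mul_rpow (by positivity) hκ0, ← Real.rpow_mul hA.le,
    show ((N : ℝ) - 2 * s) * (1 / 2) = (N : ℝ) / 2 - s by ring]
  have := Real.rpow_pos_of_pos hA ((N : ℝ) / 2 - s)
  nlinarith

lemma lintegral_enorm_sq_eq (f : L2C N) : ∫⁻ x, ‖f x‖ₑ ^ 2 = ‖f‖ₑ ^ 2 := by
  rw [Lp.enorm_def]
  have h := eLpNorm_nnreal_pow_eq_lintegral (μ := (volume : Measure (RN N))) (f := f)
    (p := 2) (by norm_num)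
  simpa using h.symm

/-- Chebyshev's inequality for the high frequencies of `𝓕⁻ F`, the low ones being bounded
by half of the level. -/
lemma measure_lt_norm_fourierInv_le (F : L2C N) {C β : ℝ} (hC : 0 < C) (hβ : 0 < β)
    (hlow : ∀ A : ℝ, 0 < A → ∫⁻ ξ in Metric.ball 0 A, ‖F ξ‖ₑ ≤ ENNReal.ofReal (C * A ^ β))
    {t : ℝ} (ht : 0 < t) :
    volume {x | t < ‖(𝓕⁻ F : L2C N) x‖}
      ≤ ENNReal.ofReal (4 * t ^ (-2 : ℝ)) * ∫⁻ ξ in {ξ | t ≤ 2 * C * ‖ξ‖ ^ β}, ‖F ξ‖ₑ ^ 2 := by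
  -- The cut-off radius solves `C A^β = t/2`. The low frequencies then contribute at most `t/2`
  -- pointwise, so where the sum exceeds `t` the high-frequency part exceeds `t/2`.
  set A : ℝ := (t / (2 * C)) ^ β⁻¹ with hA
  have hApos : 0 < A := by positivity
  have hAβ : A ^ β = t / (2 * C) := by
    rw [hA, ← Real.rpow_mul (by positivity), inv_mul_cancel₀ hβ.ne', Real.rpow_one]
  set S : Set (RN N) := Metric.ball 0 A with hS
  have hSm : MeasurableSet S := measurableSet_ball
  have hFl : MemLp (S.indicator F) 2 volume := (Lp.memLp F).indicator hSm
  have hFh : MemLp (Sᶜ.indicator F) 2 volume := (Lp.memLp F).indicator hSm.compl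
  have hsum : F = hFl.toLp + hFh.toLp := by
    rw [← MemLp.toLp_add]
    refine Lp.ext ?_
    filter_upwards [MemLp.coeFn_toLp (hFl.add hFh)] with x hx
    rw [hx, Set.indicator_self_add_compl]
  have hl1 : ∫⁻ ξ, ‖(hFl.toLp : L2C N) ξ‖ₑ ≤ ENNReal.ofReal (t / 2) := by
    have : ∫⁻ ξ, ‖(hFl.toLp : L2C N) ξ‖ₑ = ∫⁻ ξ in S, ‖F ξ‖ₑ := by
      rw [← lintegral_indicator hSm]
      refine lintegral_congr_ae ?_
      filter_upwards [MemLp.coeFn_toLp hFl] with x hx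
      rw [hx, enorm_indicator_eq_indicator_enorm]
    rw [this]
    refine (hlow A hApos).trans (le_of_eq ?_)
    rw [hAβ]
    congr 1
    field_simp
  have hint : Integrable (hFl.toLp : L2C N) volume :=
    ⟨(Lp.aestronglyMeasurable _), lt_of_le_of_lt hl1 ENNReal.ofReal_lt_top⟩
  have hl2 : ∫ ξ, ‖(hFl.toLp : L2C N) ξ‖ ≤ t / 2 := by
    rw [integral_norm_eq_lintegral_enorm hint.1]
    exact ENNReal.toReal_le_of_le_ofReal (by positivity) hl1
  have hsub : volume {x | t < ‖(𝓕⁻ F : L2C N) x‖}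
      ≤ volume {x | ENNReal.ofReal (t ^ 2 / 4) ≤ ‖(𝓕⁻ (hFh.toLp : L2C N) : L2C N) x‖ₑ ^ 2} := by
    refine measure_mono_ae ?_
    have hdec : (𝓕⁻ F : L2C N) = 𝓕⁻ (hFl.toLp : L2C N) + 𝓕⁻ (hFh.toLp : L2C N) := by
      rw [← FourierTransform.fourierInv_add, ← hsum]
    rw [hdec]
    filter_upwards [coeFn_fourierInv_of_integrable _ hint,
      Lp.coeFn_add (𝓕⁻ (hFl.toLp : L2C N) : L2C N) (𝓕⁻ (hFh.toLp : L2C N))] with x h1 h2 h3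
    change t < ‖_‖ at h3
    rw [h2, Pi.add_apply, h1] at h3
    have h4 := norm_fourierInv_le_integral_norm (hFl.toLp : L2C N) x
    have h5 := norm_add_le (𝓕⁻ ((hFl.toLp : L2C N) : RN N → ℂ) x)
      ((𝓕⁻ (hFh.toLp : L2C N) : L2C N) x)
    change _ ≤ _
    rw [← ofReal_norm, ← ENNReal.ofReal_pow (norm_nonneg _)]
    refine ENNReal.ofReal_le_ofReal ?_
    nlinarith
  have hcheb := mul_meas_ge_le_lintegral₀ (μ := (volume : Measure (RN N)))
    (f := fun x => ‖(𝓕⁻ (hFh.toLp : L2C N) : L2C N) x‖ₑ ^ 2)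
    ((Lp.aestronglyMeasurable _).enorm.pow_const 2) (ENNReal.ofReal (t ^ 2 / 4))
  have hnorm : ∫⁻ x, ‖(𝓕⁻ (hFh.toLp : L2C N) : L2C N) x‖ₑ ^ 2
      ≤ ∫⁻ ξ in {ξ | t ≤ 2 * C * ‖ξ‖ ^ β}, ‖F ξ‖ₑ ^ 2 := by
    have h1 : ‖(𝓕⁻ (hFh.toLp : L2C N) : L2C N)‖ₑ = ‖(hFh.toLp : L2C N)‖ₑ := by
      rw [← ofReal_norm, ← ofReal_norm]
      congr 1
      exact (Lp.fourierTransformₗᵢ (RN N) ℂ).symm.norm_map _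
    rw [lintegral_enorm_sq_eq, h1, ← lintegral_enorm_sq_eq]
    have h2 : ∫⁻ x, ‖(hFh.toLp : L2C N) x‖ₑ ^ 2 = ∫⁻ ξ in Sᶜ, ‖F ξ‖ₑ ^ 2 := by
      rw [← lintegral_indicator hSm.compl]
      refine lintegral_congr_ae ?_
      filter_upwards [MemLp.coeFn_toLp hFh] with x hx
      rw [hx]
      by_cases h : x ∈ Sᶜ <;> simp [h]
    rw [h2]
    refine lintegral_mono_set fun ξ hξ => ?_
    have h3 : A ≤ ‖ξ‖ := by simpa [hS] using hξ
    have h4 := Real.rpow_le_rpow hApos.le h3 hβ.le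
    rw [hAβ, div_le_iff₀ (by positivity)] at h4
    change t ≤ _
    linarith
  calc volume {x | t < ‖(𝓕⁻ F : L2C N) x‖}
      = ENNReal.ofReal (4 * t ^ (-2 : ℝ)) * (ENNReal.ofReal (t ^ 2 / 4)
          * volume {x | t < ‖(𝓕⁻ F : L2C N) x‖}) := by
        rw [← mul_assoc, ← ENNReal.ofReal_mul (by positivity), Real.rpow_neg ht.le, Real.rpow_two,
          show 4 * (t ^ 2)⁻¹ * (t ^ 2 / 4) = 1 by field_simp, ENNReal.ofReal_one, one_mul]
    _ ≤ _ := by gcongr; exact (mul_le_mul_right hsub _).trans (hcheb.trans hnorm)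

lemma lintegral_Ioc_rpow {q : ℝ} (hq : 0 < q) {T : ℝ} (hT : 0 ≤ T) :
    ∫⁻ t in Set.Ioc 0 T, ENNReal.ofReal (t ^ (q - 1)) = ENNReal.ofReal (T ^ q / q) := by
  have h := integral_rpow (a := 0) (b := T) (r := q - 1) (Or.inl (by linarith))
  rw [sub_add_cancel, Real.zero_rpow hq.ne', sub_zero] at h
  rw [← h, intervalIntegral.integral_of_le hT, ofReal_integral_eq_lintegral_ofReal]
  · exact (intervalIntegrable_iff_integrableOn_Ioc_of_le hT).1
      (intervalIntegral.intervalIntegrable_rpow' (by linarith))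
  · filter_upwards [ae_restrict_mem measurableSet_Ioc] with t ht
    have := ht.1.le
    positivity

/-- The fractional Sobolev embedding, in terms of the Fourier transform. -/
lemma lintegral_rpow_norm_fourierInv_lt_top (hN : 1 ≤ N) (hs0 : 0 < s) (hs : 2 * s < N)
    (F : L2C N) (hsF : ∫⁻ ξ, ENNReal.ofReal (‖ξ‖ ^ (2 * s) * ‖F ξ‖ ^ 2) < ∞) :
    ∫⁻ x, ENNReal.ofReal (‖(𝓕⁻ F : L2C N) x‖ ^ critExp N s) < ∞ := by
  have hFm : Measurable F := (Lp.stronglyMeasurable F).measurable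
  obtain ⟨C, hC, hlow⟩ := exists_lintegral_ball_le hN hs hFm hsF
  have hd : 0 < (N : ℝ) - 2 * s := by linarith
  have hβ : 0 < (N : ℝ) / 2 - s := by linarith
  set β : ℝ := (N : ℝ) / 2 - s with hβd
  set p := critExp N s with hp
  have hp2 : p - 2 = 4 * s / (N - 2 * s) := by
    rw [hp, critExp]
    field_simp
    ring
  have hp2pos : 0 < p - 2 := by rw [hp2]; positivity
  -- This is where the critical exponent enters: integrating `t^(p-3)` up to `2C|ξ|^β` must produce
  -- exactly the weight `|ξ|^(2s)`.
  have hβp : β * (p - 2) = 2 * s := by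
    rw [hp2, hβd]
    field_simp
    ring
  -- Layer-cake formula: each level set is estimated with its own cut-off, and Tonelli then lets the
  -- integral over `t` be computed first.
  rw [lintegral_rpow_eq_lintegral_meas_lt_mul _ (ae_of_all _ fun _ => norm_nonneg _)
    (Lp.aestronglyMeasurable _).norm.aemeasurable (by linarith)]
  refine ENNReal.mul_lt_top ENNReal.ofReal_lt_top ?_
  set k : ℝ → RN N → ℝ≥0∞ := fun t ξ =>
    Set.indicator {z : ℝ × RN N | z.1 ≤ 2 * C * ‖z.2‖ ^ β}
      (fun z => ENNReal.ofReal (4 * z.1 ^ (p - 2 - 1)) * ‖F z.2‖ₑ ^ 2) (t, ξ) with hk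
  have hkset : MeasurableSet {z : ℝ × RN N | z.1 ≤ 2 * C * ‖z.2‖ ^ β} :=
    measurableSet_le measurable_fst (by fun_prop)
  have hkm : Measurable (Function.uncurry k) := by
    refine Measurable.indicator ?_ hkset
    fun_prop
  have step : ∫⁻ t in Set.Ioi (0 : ℝ), volume {x | t < ‖(𝓕⁻ F : L2C N) x‖}
        * ENNReal.ofReal (t ^ (p - 1)) ≤ ∫⁻ t in Set.Ioi (0 : ℝ), ∫⁻ ξ, k t ξ := by
    refine setLIntegral_mono' measurableSet_Ioi fun t ht => ?_
    have ht : 0 < t := ht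
    refine (mul_le_mul_left (measure_lt_norm_fourierInv_le F hC hβ hlow ht) _).trans (le_of_eq ?_)
    have hm : MeasurableSet {ξ : RN N | t ≤ 2 * C * ‖ξ‖ ^ β} :=
      measurableSet_le measurable_const (by fun_prop)
    rw [mul_right_comm, ← ENNReal.ofReal_mul (by positivity), mul_assoc 4, ← Real.rpow_add ht,
      show (-2 : ℝ) + (p - 1) = p - 2 - 1 by ring, ← lintegral_const_mul _ (by fun_prop),
      ← lintegral_indicator hm]
    rfl
  refine lt_of_le_of_lt step ?_
  rw [lintegral_lintegral_swap hkm.aemeasurable]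
  have hinner : ∀ ξ, ∫⁻ t in Set.Ioi (0 : ℝ), k t ξ
      = ENNReal.ofReal (4 * (2 * C) ^ (p - 2) / (p - 2))
        * ENNReal.ofReal (‖ξ‖ ^ (2 * s) * ‖F ξ‖ ^ 2) := by
    intro ξ
    have hT : 0 ≤ 2 * C * ‖ξ‖ ^ β := by positivity
    have h1 : ∫⁻ t in Set.Ioi (0 : ℝ), k t ξ = ∫⁻ t in Set.Ioi (0 : ℝ),
        (Set.Iic (2 * C * ‖ξ‖ ^ β)).indicator
          (fun t => ENNReal.ofReal (t ^ (p - 2 - 1)) * (ENNReal.ofReal 4 * ‖F ξ‖ₑ ^ 2)) t := by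
      refine setLIntegral_congr_fun measurableSet_Ioi fun t ht => ?_
      have ht : 0 < t := ht
      simp only [hk, Set.indicator, Set.mem_ofPred_eq, Set.mem_Iic]
      rw [ENNReal.ofReal_mul (by norm_num)]
      split_ifs <;> ring
    rw [h1, lintegral_indicator measurableSet_Iic, Measure.restrict_restrict measurableSet_Iic,
      Set.inter_comm, Set.Ioi_inter_Iic, lintegral_mul_const _ (by fun_prop),
      lintegral_Ioc_rpow hp2pos hT, Real.mul_rpow (by positivity) (by positivity),
      ← Real.rpow_mul (norm_nonneg _), hβp, ← ofReal_norm, ← ENNReal.ofReal_pow (norm_nonneg _),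
      ← ENNReal.ofReal_mul (by norm_num), ← ENNReal.ofReal_mul (by positivity),
      ← ENNReal.ofReal_mul (by positivity)]
    congr 1
    ring
  simp_rw [hinner]
  rw [lintegral_const_mul _ (by fun_prop)]
  exact ENNReal.mul_lt_top ENNReal.ofReal_lt_top hsF

/-- The fractional Sobolev embedding `H^s ⊆ L^{2^*_s}`. -/
lemma integrable_rpow_critExp (hN : 1 ≤ N) (hs0 : 0 < s) (hs : 2 * s < N) (u : Hs N s) :
    Integrable (fun x => |(u : L2 N) x| ^ critExp N s) volume := by
  have h2 : Integrable (fun ξ => ‖symbolMul s (u : L2 N) ξ‖ ^ 2) volume :=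
    MemLp.integrable_norm_pow (p := 2) u.2 (by simp)
  have h : ∫⁻ ξ, ENNReal.ofReal (‖ξ‖ ^ (2 * s) * ‖(𝓕 (complexify N (u : L2 N)) : L2C N) ξ‖ ^ 2)
      < ∞ := by
    refine lt_of_eq_of_lt (lintegral_congr fun ξ => ?_)
      (h2.const_mul ((2 * Real.pi) ^ (-(2 * s)))).lintegral_lt_top
    rw [symbolMul, norm_smul, mul_pow, Real.norm_of_nonneg (by positivity),
      Real.mul_rpow (by positivity) (norm_nonneg _), mul_pow, ← Real.rpow_mul_natCast (by positivity),
      ← Real.rpow_mul_natCast (norm_nonneg _), Real.rpow_neg (by positivity)]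
    congr 1
    push_cast
    rw [mul_comm s 2]
    have : 0 < (2 * Real.pi) ^ (2 * s) := by positivity
    field_simp
  have h3 := lintegral_rpow_norm_fourierInv_lt_top hN hs0 hs _ h
  rw [FourierTransform.fourierInv_fourier_eq] at h3
  have hm : AEStronglyMeasurable (fun x => |(u : L2 N) x| ^ critExp N s) volume :=
    ((Lp.stronglyMeasurable (u : L2 N)).measurable.abs.pow_const _).aestronglyMeasurable
  refine ⟨hm, (hasFiniteIntegral_iff_ofReal (ae_of_all _ fun _ => by positivity)).2 ?_⟩
  refine lt_of_eq_of_lt (lintegral_congr_ae ?_) h3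
  filter_upwards [coeFn_complexify (u : L2 N)] with x hx
  rw [hx, Complex.norm_real, Real.norm_eq_abs]

/-! ### Growth of the nonlinearity and of its primitive -/

variable {g : ℝ → ℝ}

lemma critExp_gt_two (hs0 : 0 < s) (hs : 2 * s < N) : 2 < critExp N s := by
  have hd : 0 < (N : ℝ) - 2 * s := by linarith
  rw [critExp, lt_div_iff₀ hd]
  linarith

lemma IsAdmissible.exists_growth (hg : IsAdmissible N s g) :
    ∃ C, 0 ≤ C ∧ ∀ t, |g t| ≤ C * (1 + |t| ^ (critExp N s - 1)) := by
  obtain ⟨M, hM, -⟩ := EReal.lt_iff_exists_real_btwn.1 hg.limsup_infty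
  have hev := eventually_sup.1 (eventually_lt_of_limsup_lt hM)
  obtain ⟨a, ha⟩ := eventually_atBot.1 hev.1
  obtain ⟨b, hb⟩ := eventually_atTop.1 hev.2
  set R := max (|a| + |b|) 1
  have hR1 : 1 ≤ R := le_max_right _ _
  have hRab : |a| + |b| ≤ R := le_max_left _ _
  obtain ⟨D, hD⟩ := (isCompact_Icc (a := -R) (b := R)).exists_bound_of_continuousOn
    hg.continuous.continuousOn
  refine ⟨max D 0 + max M 0, by positivity, fun t => ?_⟩
  have h0 : 0 ≤ |t| ^ (critExp N s - 1) := by positivity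
  rcases le_or_gt |t| R with h | h
  · have h1 := hD t (abs_le.1 h)
    rw [Real.norm_eq_abs] at h1
    have h2 := le_max_left D 0
    have h3 := le_max_right D 0
    have h4 := le_max_right M 0
    nlinarith [mul_nonneg h3 h0, mul_nonneg h4 h0]
  · have ht : 0 < |t| := by linarith
    have h1 : |g t| / |t| ^ (critExp N s - 1) < M := by
      rcases le_total 0 t with h' | h'
      · rw [abs_of_nonneg h'] at h
        exact_mod_cast hb t (by linarith [le_abs_self b, abs_nonneg a])
      · rw [abs_of_nonpos h'] at h
        exact_mod_cast ha t (by linarith [neg_abs_le a, abs_nonneg b])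
    rw [div_lt_iff₀ (by positivity)] at h1
    have h2 := le_max_left M 0
    have h3 := le_max_right D 0
    have h4 := le_max_right M 0
    nlinarith [mul_nonneg h3 h0, mul_le_mul_of_nonneg_right h2 h0]

/-- Supplies a majorant uniform over bounded shifts; multiplied by a Schwartz function it becomes
integrable. Either `|a| ≤ M` and `|a + b| ≤ 2M`, or `|a + b| ≤ 2|a|`, whence the two constants. -/
lemma IsAdmissible.exists_shift_growth (hg : IsAdmissible N s g) (hp : 2 < critExp N s) {M : ℝ}
    (hM : 0 ≤ M) :
    ∃ D, 0 ≤ D ∧ ∀ a b, |b| ≤ M → |g (a + b)| ≤ D * (1 + |a| ^ critExp N s) := by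
  obtain ⟨C, hC, h⟩ := hg.exists_growth
  set p := critExp N s
  refine ⟨C * (1 + (2 * M) ^ (p - 1) + 2 ^ (p - 1)), by positivity, fun a b hb => ?_⟩
  refine (h _).trans ?_
  rw [mul_assoc]
  refine mul_le_mul_of_nonneg_left ?_ hC
  have h0 : 0 ≤ |a| ^ p := by positivity
  have h1 : |a| ^ (p - 1) ≤ 1 + |a| ^ p := by
    rcases le_total |a| 1 with h | h
    · have := Real.rpow_le_one (abs_nonneg a) h (show 0 ≤ p - 1 by linarith)
      linarith
    · have := Real.rpow_le_rpow_of_exponent_le h (show p - 1 ≤ p by linarith)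
      linarith
  have hab : |a + b| ≤ |a| + M := (abs_add_le a b).trans (by linarith)
  have hA : 0 ≤ (2 * M) ^ (p - 1) := by positivity
  have hB : (0 : ℝ) ≤ 2 ^ (p - 1) := by positivity
  have h2 : |a + b| ^ (p - 1) ≤ (2 * M) ^ (p - 1) + 2 ^ (p - 1) * |a| ^ (p - 1) := by
    rw [← Real.mul_rpow (by norm_num) (abs_nonneg a)]
    rcases le_total |a| M with h | h
    · have := Real.rpow_le_rpow (abs_nonneg _) (show |a + b| ≤ 2 * M by linarith)
        (show 0 ≤ p - 1 by linarith)
      have : 0 ≤ (2 * |a|) ^ (p - 1) := by positivity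
      linarith
    · have := Real.rpow_le_rpow (abs_nonneg _) (show |a + b| ≤ 2 * |a| by linarith)
        (show 0 ≤ p - 1 by linarith)
      linarith
  nlinarith [mul_nonneg hA h0, mul_le_mul_of_nonneg_left h1 hB]

lemma primitive_sub (hg : Continuous g) (a b : ℝ) :
    primitive g b - primitive g a = ∫ τ in a..b, g τ :=
  intervalIntegral.integral_interval_sub_left (hg.intervalIntegrable _ _)
    (hg.intervalIntegrable _ _)

lemma hasDerivAt_primitive (hg : Continuous g) (t : ℝ) : HasDerivAt (primitive g) (g t) t :=
  hg.integral_hasStrictDerivAt 0 t |>.hasDerivAt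

lemma continuous_primitive (hg : Continuous g) : Continuous (primitive g) :=
  continuous_iff_continuousAt.2 fun t => (hasDerivAt_primitive hg t).continuousAt

lemma IsAdmissible.exists_primitive_shift_le (hg : IsAdmissible N s g) (hp : 2 < critExp N s)
    {M : ℝ} (hM : 0 ≤ M) : ∃ D, 0 ≤ D ∧ ∀ a b, |b| ≤ M →
      |primitive g (a + b) - primitive g a| ≤ D * (1 + |a| ^ critExp N s) * |b| := by
  obtain ⟨D, hD, h⟩ := hg.exists_shift_growth hp hM
  refine ⟨D, hD, fun a b hb => ?_⟩
  rw [primitive_sub hg.continuous, ← Real.norm_eq_abs]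
  refine (intervalIntegral.norm_integral_le_of_norm_le_const
    (C := D * (1 + |a| ^ critExp N s)) fun τ hτ => ?_).trans (by rw [add_sub_cancel_left])
  have : |τ - a| ≤ M := by
    have := Set.abs_sub_left_of_mem_uIcc (Set.uIoc_subset_uIcc hτ)
    rw [add_sub_cancel_left] at this
    linarith
  simpa using h a (τ - a) this

/-- Near zero, (g1) gives `g(τ)/τ ≤ 1`; away from zero the growth bound applies, and the linear term
is absorbed by `t²/δ`. As (g1) is one-sided, only an upper bound is available, and `∫ G(u)` may
equal `-∞`. -/
lemma IsAdmissible.exists_primitive_le (hg : IsAdmissible N s g) (hp : 2 < critExp N s) :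
    ∃ C, 0 ≤ C ∧ ∀ t, primitive g t ≤ C * (t ^ 2 + |t| ^ critExp N s) := by
  obtain ⟨C, hC, h⟩ := hg.exists_growth
  have hlt : limsup (fun t : ℝ => ((g t / t : ℝ) : EReal)) (𝓝[≠] 0) < ((1 : ℝ) : EReal) :=
    lt_of_le_of_lt hg.limsup_zero (by exact_mod_cast zero_lt_one)
  have hev := eventually_lt_of_limsup_lt hlt
  rw [eventually_nhdsWithin_iff, Metric.eventually_nhds_iff] at hev
  obtain ⟨δ, hδ, hev⟩ := hev
  have hsmall : ∀ t, |t| < δ → primitive g t ≤ t ^ 2 := by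
    intro t ht
    have key : ∀ τ, |τ| < δ → τ ≠ 0 → g τ / τ ≤ 1 := fun τ h1 h2 => by
      have := hev (y := τ) (by simpa using h1) (by simpa using h2)
      exact_mod_cast this.le
    rcases le_total 0 t with h0 | h0
    · have : primitive g t ≤ ∫ _ in (0 : ℝ)..t, t := by
        refine intervalIntegral.integral_mono_on h0 (hg.continuous.intervalIntegrable _ _)
          (by simp) fun τ hτ => ?_
        rcases eq_or_ne τ 0 with rfl | hne
        · rw [hg.map_zero]; exact h0
        · have hpos : 0 < τ := lt_of_le_of_ne hτ.1 hne.symm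
          have := key τ (by rw [abs_of_pos hpos]; rw [abs_of_nonneg h0] at ht; linarith [hτ.2]) hne
          rw [div_le_one hpos] at this
          linarith [hτ.2]
      refine this.trans (le_of_eq ?_)
      simp
      ring
    · have : ∫ _ in t..(0 : ℝ), t ≤ ∫ τ in t..(0 : ℝ), g τ := by
        refine intervalIntegral.integral_mono_on h0 (by simp)
          (hg.continuous.intervalIntegrable _ _) fun τ hτ => ?_
        rcases eq_or_ne τ 0 with rfl | hne
        · rw [hg.map_zero]; exact h0
        · have hneg : τ < 0 := lt_of_le_of_ne hτ.2 hne
          have := key τ (by rw [abs_of_neg hneg]; rw [abs_of_nonpos h0] at ht; linarith [hτ.1]) hne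
          rw [div_le_one_of_neg hneg] at this
          linarith [hτ.1]
      rw [primitive, intervalIntegral.integral_symm]
      simp at this
      nlinarith
  refine ⟨1 + C * (1 + δ⁻¹), by positivity, fun t => ?_⟩
  have hp0 : 0 ≤ |t| ^ critExp N s := by positivity
  rcases lt_or_ge |t| δ with ht | ht
  · refine (hsmall t ht).trans ?_
    have : 0 ≤ C * (1 + δ⁻¹) := by positivity
    nlinarith [mul_nonneg this hp0, mul_nonneg this (sq_nonneg t)]
  · have htpos : 0 < |t| := by linarith
    have h1 : |primitive g t| ≤ C * (1 + |t| ^ (critExp N s - 1)) * |t| := by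
      rw [primitive, ← Real.norm_eq_abs]
      refine (intervalIntegral.norm_integral_le_of_norm_le_const
        (C := C * (1 + |t| ^ (critExp N s - 1))) fun τ hτ => ?_).trans (by rw [sub_zero])
      refine (h τ).trans ?_
      have : |τ| ≤ |t| := by
        simpa using Set.abs_sub_left_of_mem_uIcc (Set.uIoc_subset_uIcc hτ)
      have := Real.rpow_le_rpow (abs_nonneg _) this (show 0 ≤ critExp N s - 1 by linarith)
      gcongr
    have h2 : |t| ^ (critExp N s - 1) * |t| = |t| ^ critExp N s := by
      rw [← Real.rpow_add_one htpos.ne', sub_add_cancel]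
    have h3 : |t| ≤ δ⁻¹ * t ^ 2 := by
      rw [← sq_abs, sq, ← mul_assoc]
      have : 1 ≤ δ⁻¹ * |t| := by rwa [inv_mul_eq_div, one_le_div hδ]
      nlinarith
    have h4 : primitive g t ≤ C * (|t| + |t| ^ critExp N s) := by
      refine (le_abs_self _).trans (h1.trans (le_of_eq ?_))
      rw [← h2]; ring
    refine h4.trans ?_
    have hδ' : 0 ≤ δ⁻¹ := by positivity
    have e1 : C * (|t| + |t| ^ critExp N s) ≤ C * (δ⁻¹ * t ^ 2 + |t| ^ critExp N s) := by gcongr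
    refine e1.trans ?_
    nlinarith [mul_nonneg hC (sq_nonneg t), mul_nonneg (mul_nonneg hC hδ') hp0, sq_nonneg t]

/-- The real-valued integral `∫ G(u) dx`. -/
def potentialReal (g : ℝ → ℝ) (u : Hs N s) : ℝ := ∫ x, primitive g ((u : L2 N) x)

/-! ### Reduction of the extended-real functionals to real ones -/

lemma extIntegral_eq_coe {f : RN N → ℝ} (hf : Integrable f volume) :
    extIntegral f = ((∫ x, f x : ℝ) : EReal) := by
  rw [extIntegral, integral_eq_lintegral_pos_part_sub_lintegral_neg_part hf, EReal.coe_sub,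
    EReal.coe_ennreal_toReal hf.lintegral_lt_top.ne, EReal.coe_ennreal_toReal]
  exact hf.neg.lintegral_lt_top.ne

lemma integrable_of_lintegral_ofReal {f : RN N → ℝ} (hm : AEStronglyMeasurable f volume)
    (h1 : ∫⁻ x, ENNReal.ofReal (f x) < ∞) (h2 : ∫⁻ x, ENNReal.ofReal (-f x) < ∞) :
    Integrable f volume := by
  refine ⟨hm, ?_⟩
  have h : ∀ x, ‖f x‖ₑ ≤ ENNReal.ofReal (f x) + ENNReal.ofReal (-f x) := fun x => by
    rw [← ofReal_norm, Real.norm_eq_abs]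
    rcases le_total 0 (f x) with h | h
    · rw [abs_of_nonneg h]; exact le_self_add
    · rw [abs_of_nonpos h]; exact le_add_self
  refine lt_of_le_of_lt (lintegral_mono h) ?_
  rw [lintegral_add_left' hm.aemeasurable.ennreal_ofReal]
  exact ENNReal.add_lt_top.2 ⟨h1, h2⟩

lemma integrable_of_extIntegral {f : RN N → ℝ} (hm : AEStronglyMeasurable f volume)
    (h1 : extIntegral f ≠ ⊤) (h2 : extIntegral f ≠ ⊥) : Integrable f volume := by
  rw [extIntegral] at h1 h2
  have hn : ∫⁻ x, ENNReal.ofReal (-f x) ≠ ∞ := fun h => by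
    rw [h, EReal.coe_ennreal_top, EReal.sub_top] at h2
    exact h2 rfl
  have hpos : ∫⁻ x, ENNReal.ofReal (f x) ≠ ∞ := fun h => by
    rw [h, EReal.coe_ennreal_top, EReal.top_sub] at h1
    · exact h1 rfl
    · simpa using hn
  exact integrable_of_lintegral_ofReal hm hpos.lt_top hn.lt_top

lemma aestronglyMeasurable_primitive (hg : Continuous g) (u : Hs N s) :
    AEStronglyMeasurable (fun x => primitive g ((u : L2 N) x)) volume :=
  (continuous_primitive hg).comp_aestronglyMeasurable (Lp.aestronglyMeasurable _)

lemma IsAdmissible.integrable_of_potential_ne_bot (hg : IsAdmissible N s g) (hN : 1 ≤ N)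
    (hs0 : 0 < s) (hs : 2 * s < N) {u : Hs N s} (hu : potential g u ≠ ⊥) :
    Integrable (fun x => primitive g ((u : L2 N) x)) volume := by
  obtain ⟨C, hC, h⟩ := hg.exists_primitive_le (critExp_gt_two hs0 hs)
  refine integrable_of_extIntegral (aestronglyMeasurable_primitive hg.continuous u) (fun hT => ?_) hu
  have hfin : ∫⁻ x, ENNReal.ofReal (primitive g ((u : L2 N) x)) < ∞ :=
    lt_of_le_of_lt (lintegral_mono fun x => ENNReal.ofReal_le_ofReal (h _))
      (((integrable_sq (u : L2 N)).add
        (integrable_rpow_critExp hN hs0 hs u)).const_mul C).lintegral_lt_top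
  rw [extIntegral, sub_eq_add_neg] at hT
  refine (EReal.add_lt_top ?_ ?_).ne hT
  · simpa using hfin.ne
  · rw [Ne, EReal.neg_eq_top_iff]
    exact EReal.coe_ennreal_ne_bot _

lemma potential_eq_coe {u : Hs N s} (hu : Integrable (fun x => primitive g ((u : L2 N) x)) volume) :
    potential g u = (potentialReal g u : EReal) := extIntegral_eq_coe hu

lemma K_eq_coe {u : Hs N s} (hu : Integrable (fun x => primitive g ((u : L2 N) x)) volume) :
    K g u = ((1 / 2 * energy u - potentialReal g u : ℝ) : EReal) := by
  rw [K, potential_eq_coe hu, EReal.coe_sub]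

lemma J_eq_coe {μ : ℝ} {u : Hs N s}
    (hu : Integrable (fun x => primitive g ((u : L2 N) x)) volume) :
    J g μ u = ((1 / 2 * energy u + μ / 2 * mass u - potentialReal g u : ℝ) : EReal) := by
  rw [J, potential_eq_coe hu, EReal.coe_sub]

lemma P_eq_coe {μ : ℝ} {u : Hs N s}
    (hu : Integrable (fun x => primitive g ((u : L2 N) x)) volume) :
    P g μ u = ((energy u + critExp N s * (μ / 2 * mass u - potentialReal g u) : ℝ) : EReal) := by
  rw [P, potential_eq_coe hu]
  push_cast
  rfl

/-- An infinite potential would make `P g μ u` infinite, so points of the Pohožaev set have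
integrable `G(u)`. -/
lemma integrable_of_P_eq_zero (hg : Continuous g) {μ : ℝ} (hp : 0 < critExp N s) {u : Hs N s}
    (hu : P g μ u = 0) : Integrable (fun x => primitive g ((u : L2 N) x)) volume := by
  refine integrable_of_extIntegral (aestronglyMeasurable_primitive hg u) (fun h => ?_) (fun h => ?_)
  · change potential g u = ⊤ at h
    rw [P, h, EReal.sub_top, EReal.coe_mul_bot_of_pos hp, EReal.add_bot] at hu
    simp at hu
  · change potential g u = ⊥ at h
    rw [P, h, EReal.coe_sub_bot, EReal.coe_mul_top_of_pos hp, EReal.coe_add_top] at hu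
    simp at hu

/-! ### The potential under dilations and Schwartz perturbations -/

lemma integrable_primitive_dil {c : ℝ} (hc : 0 < c) {u : Hs N s}
    (hu : Integrable (fun x => primitive g ((u : L2 N) x)) volume) :
    Integrable (fun x => primitive g ((dil hc u : L2 N) x)) volume := by
  refine (hu.comp_smul hc.ne').congr ?_
  filter_upwards [coeFn_dil hc u] with x hx
  rw [hx]

lemma potentialReal_dil {c : ℝ} (hc : 0 < c) (u : Hs N s) :
    potentialReal g (dil hc u) = (c ^ N)⁻¹ * potentialReal g u := by
  rw [potentialReal, potentialReal,
    ← integral_comp_smul_pos hc (fun x => primitive g ((u : L2 N) x))]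
  refine integral_congr_ae ?_
  filter_upwards [coeFn_dil hc u] with x hx
  rw [hx]

lemma coeFn_add_smul_schwartzHs (hs0 : 0 ≤ s) (hs1 : s ≤ 1) (u : Hs N s)
    (φ : SchwartzMap (RN N) ℝ) (t : ℝ) :
    ((u + t • schwartzHs hs0 hs1 φ : Hs N s) : L2 N) =ᵐ[volume] fun x => (u : L2 N) x + t * φ x := by
  filter_upwards [Lp.coeFn_add (u : L2 N) (t • (schwartzHs hs0 hs1 φ : L2 N)),
    Lp.coeFn_smul t (schwartzHs hs0 hs1 φ : L2 N), coeFn_schwartzHs hs0 hs1 φ] with x h1 h2 h3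
  rw [Submodule.coe_add, Submodule.coe_smul, h1, Pi.add_apply, h2, Pi.smul_apply, h3, smul_eq_mul]

lemma exists_schwartz_bound (φ : SchwartzMap (RN N) ℝ) : ∃ M, 0 ≤ M ∧ ∀ x, |φ x| ≤ M :=
  ⟨_, norm_nonneg _, fun x => φ.toBoundedContinuousFunction.norm_coe_le_norm x⟩

lemma integrable_growth_mul_schwartz (hN : 1 ≤ N) (hs0 : 0 < s) (hs : 2 * s < N) (u : Hs N s)
    (φ : SchwartzMap (RN N) ℝ) (D : ℝ) :
    Integrable (fun x => D * (1 + |(u : L2 N) x| ^ critExp N s) * |φ x|) volume := by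
  obtain ⟨M, -, hM⟩ := exists_schwartz_bound φ
  have h1 : Integrable (fun x => |(u : L2 N) x| ^ critExp N s * |φ x|) volume :=
    (integrable_rpow_critExp hN hs0 hs u).mul_bdd (c := M) φ.continuous.abs.aestronglyMeasurable
      (ae_of_all _ fun x => by simpa using hM x)
  refine ((φ.integrable.abs.add h1).const_mul D).congr (ae_of_all _ fun x => ?_)
  simp only [Pi.add_apply]
  ring

lemma IsAdmissible.integrable_primitive_add_schwartz (hg : IsAdmissible N s g) (hN : 1 ≤ N)
    (hs0 : 0 < s) (hs1 : s ≤ 1) (hs : 2 * s < N) {u : Hs N s}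
    (hu : Integrable (fun x => primitive g ((u : L2 N) x)) volume) (φ : SchwartzMap (RN N) ℝ)
    (t : ℝ) :
    Integrable (fun x => primitive g (((u + t • schwartzHs hs0.le hs1 φ : Hs N s) : L2 N) x)) volume := by
  obtain ⟨M, hM0, hM⟩ := exists_schwartz_bound (t • φ)
  obtain ⟨D, hD, h⟩ := hg.exists_primitive_shift_le (critExp_gt_two hs0 hs) hM0
  have hd : Integrable (fun x => primitive g (((u + t • schwartzHs hs0.le hs1 φ : Hs N s) : L2 N) x)
      - primitive g ((u : L2 N) x)) volume := by
    refine (integrable_growth_mul_schwartz hN hs0 hs u (t • φ) D).mono'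
      ((aestronglyMeasurable_primitive hg.continuous _).sub hu.1) ?_
    filter_upwards [coeFn_add_smul_schwartzHs hs0.le hs1 u φ t] with x hx
    rw [hx, Real.norm_eq_abs]
    exact h _ _ (hM x)
  refine (hd.add hu).congr (ae_of_all _ fun x => ?_)
  simp

/-- Differentiation under the integral, dominated for `|t| < 1` by `D (1 + |u|^(2^*_s)) |φ|`. The
direction must be bounded and integrable for this, hence Schwartz functions. -/
lemma IsAdmissible.hasDerivAt_potentialReal (hg : IsAdmissible N s g) (hN : 1 ≤ N)
    (hs0 : 0 < s) (hs1 : s ≤ 1) (hs : 2 * s < N) {u : Hs N s}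
    (hu : Integrable (fun x => primitive g ((u : L2 N) x)) volume) (φ : SchwartzMap (RN N) ℝ) :
    HasDerivAt (fun t : ℝ => potentialReal g (u + t • schwartzHs hs0.le hs1 φ))
      (∫ x, g ((u : L2 N) x) * φ x) 0 := by
  obtain ⟨M, hM0, hM⟩ := exists_schwartz_bound φ
  obtain ⟨D, hD, h⟩ := hg.exists_shift_growth (critExp_gt_two hs0 hs) hM0
  have hfun : (fun t : ℝ => potentialReal g (u + t • schwartzHs hs0.le hs1 φ))
      = fun t => ∫ x, primitive g ((u : L2 N) x + t * φ x) := by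
    ext t
    refine integral_congr_ae ?_
    filter_upwards [coeFn_add_smul_schwartzHs hs0.le hs1 u φ t] with x hx
    rw [hx]
  have hm : ∀ t : ℝ, AEStronglyMeasurable (fun x => (u : L2 N) x + t * φ x) volume := fun t =>
    (Lp.aestronglyMeasurable _).add (continuous_const.mul φ.continuous).aestronglyMeasurable
  rw [hfun]
  have key := hasDerivAt_integral_of_dominated_loc_of_deriv_le
    (μ := (volume : Measure (RN N))) (F := fun t x => primitive g ((u : L2 N) x + t * φ x))
    (F' := fun t x => g ((u : L2 N) x + t * φ x) * φ x) (x₀ := (0 : ℝ))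
    (bound := fun x => D * (1 + |(u : L2 N) x| ^ critExp N s) * |φ x|)
    (Metric.ball_mem_nhds (0 : ℝ) one_pos)
    (Eventually.of_forall fun t => (continuous_primitive hg.continuous).comp_aestronglyMeasurable
      (hm t)) (by simpa using hu)
    ((hg.continuous.comp_aestronglyMeasurable (hm 0)).mul φ.continuous.aestronglyMeasurable)
    (ae_of_all _ fun x t ht => ?_) (integrable_growth_mul_schwartz hN hs0 hs u φ D)
    (ae_of_all _ fun x t _ => ?_)
  · simpa using key.2
  · rw [norm_mul, Real.norm_eq_abs, Real.norm_eq_abs]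
    refine mul_le_mul_of_nonneg_right (h _ _ ?_) (abs_nonneg _)
    rw [abs_mul]
    have : |t| < 1 := by simpa using ht
    nlinarith [hM x, abs_nonneg (φ x), abs_nonneg t]
  · have h1 : HasDerivAt (fun t : ℝ => (u : L2 N) x + t * φ x) (φ x) t := by
      simpa using ((hasDerivAt_id t).mul_const (φ x)).const_add ((u : L2 N) x)
    exact (hasDerivAt_primitive hg.continuous _).comp t h1

/-- Dilating to mass `m`. -/
lemma exists_dil_mass_eq (hN : 1 ≤ N) {m : ℝ} (hm : 0 < m) {w : Hs N s} (hw : 0 < mass w)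
    (hi : Integrable (fun x => primitive g ((w : L2 N) x)) volume) :
    ∃ w' : Hs N s, mass w' = m ∧ Integrable (fun x => primitive g ((w' : L2 N) x)) volume ∧
      energy w' = (mass w / m) ^ ((2 * s - N) / N) * energy w ∧
      potentialReal g w' = (mass w / m)⁻¹ * potentialReal g w := by
  have hN0 : (N : ℝ) ≠ 0 := by positivity
  have hq : 0 < mass w / m := by positivity
  have hc : 0 < (mass w / m) ^ (N : ℝ)⁻¹ := by positivity
  have hcN : ((mass w / m) ^ (N : ℝ)⁻¹) ^ N = mass w / m := by
    rw [← Real.rpow_mul_natCast hq.le, inv_mul_cancel₀ hN0, Real.rpow_one]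
  refine ⟨dil hc w, ?_, integrable_primitive_dil hc hi, ?_, ?_⟩
  · rw [mass_dil, hcN]
    field_simp
  · rw [energy_dil, ← Real.rpow_mul hq.le]
    congr 2
    ring
  · rw [potentialReal_dil, hcN]

lemma schwartzHs_ne_zero (hs0 : 0 ≤ s) (hs1 : s ≤ 1) {u : L2 N} {φ : SchwartzMap (RN N) ℝ}
    (h : ∫ x, u x * φ x ≠ 0) : schwartzHs hs0 hs1 φ ≠ 0 := by
  intro h0
  refine h (integral_eq_zero_of_ae ?_)
  filter_upwards [coeFn_schwartzHs hs0 hs1 φ, Lp.coeFn_zero ℝ 2 (volume : Measure (RN N))]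
    with x h1 h2
  rw [h0, ZeroMemClass.coe_zero, h2] at h1
  simp [← h1]

/-! ### L²-minima: finiteness, Pohožaev identity and comparison -/

/-- Provides a competitor with finite `K`: a nonzero Schwartz function dilated to mass `m`. The
function `u` serves only to produce it. -/
lemma IsAdmissible.exists_mem_sphere_integrable (hg : IsAdmissible N s g) (hN : 1 ≤ N)
    (hs0 : 0 < s) (hs1 : s ≤ 1) (hs : 2 * s < N) {m : ℝ} (hm : 0 < m) {u : Hs N s} (hu : u ≠ 0) :
    ∃ w : Hs N s, mass w = m ∧ Integrable (fun x => primitive g ((w : L2 N) x)) volume := by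
  obtain ⟨φ, hφ⟩ := exists_schwartz_integral_ne_zero hu
  have hpos := mass_pos (schwartzHs_ne_zero hs0.le hs1 hφ)
  have h0 : Integrable (fun x => primitive g (((0 : Hs N s) : L2 N) x)) volume := by
    refine (integrable_zero (RN N) ℝ volume).congr ?_
    filter_upwards [Lp.coeFn_zero ℝ 2 (volume : Measure (RN N))] with x h2
    rw [ZeroMemClass.coe_zero, h2]
    simp [primitive]
  have h1 := hg.integrable_primitive_add_schwartz hN hs0 hs1 hs h0 φ 1
  obtain ⟨w, hw, hi, -⟩ := exists_dil_mass_eq hN hm (by simpa using hpos) h1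
  exact ⟨w, hw, hi⟩

/-- A competitor of finite `K` excludes `K g u = ⊤`, that is `∫ G(u) = -∞`; the Sobolev embedding
excludes `+∞`. -/
lemma IsL2Min.le_and_integrable (hg : IsAdmissible N s g) (hN : 1 ≤ N)
    (hs0 : 0 < s) (hs1 : s ≤ 1) (hs : 2 * s < N) {m : ℝ} (hm : 0 < m) {u : Hs N s}
    (hu : IsL2Min g m u) :
    mass u = m ∧ Integrable (fun x => primitive g ((u : L2 N) x)) volume ∧
      ∀ w : Hs N s, mass w = m → Integrable (fun x => primitive g ((w : L2 N) x)) volume →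
        1 / 2 * energy u - potentialReal g u ≤ 1 / 2 * energy w - potentialReal g w := by
  have hmass : mass u = m := hu.1
  have hle : ∀ w : Hs N s, mass w = m → K g u ≤ K g w := fun w hw => hu.2 ▸ iInf₂_le w hw
  have hu0 : u ≠ 0 := fun h => by
    rw [(mass_eq_zero_iff u).2 h] at hmass
    exact hm.ne hmass
  have hi : Integrable (fun x => primitive g ((u : L2 N) x)) volume := by
    refine hg.integrable_of_potential_ne_bot hN hs0 hs fun hbot => ?_
    obtain ⟨w, hw, hwi⟩ := hg.exists_mem_sphere_integrable hN hs0 hs1 hs hm hu0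
    have h := hle w hw
    rw [K_eq_coe hwi, K, hbot, EReal.coe_sub_bot, top_le_iff] at h
    exact EReal.coe_ne_top _ h
  refine ⟨hmass, hi, fun w hw hwi => ?_⟩
  have h := hle w hw
  rw [K_eq_coe hwi, K_eq_coe hi] at h
  exact_mod_cast h

lemma hasDerivAt_quadratic_zero (A B C : ℝ) :
    HasDerivAt (fun t : ℝ => A + 2 * t * B + t ^ 2 * C) (2 * B) 0 := by
  have h2 := (((hasDerivAt_id (0 : ℝ)).const_mul 2).mul_const B).const_add A
  have h3 := ((hasDerivAt_id (0 : ℝ)).pow 2).mul_const C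
  refine (h2.add h3).congr_deriv ?_
  simp

/-- The Pohožaev identity for `L²`-minima. -/
lemma pohozaev_of_isL2MinWithMultiplier (hg : IsAdmissible N s g) (hN : 1 ≤ N)
    (hs0 : 0 < s) (hs1 : s ≤ 1) (hs : 2 * s < N) {m μ : ℝ} (hm : 0 < m) {u : Hs N s}
    (hu : IsL2MinWithMultiplier g m μ u) :
    energy u + critExp N s * (μ / 2 * m - potentialReal g u) = 0 := by
  obtain ⟨hmass, hi, hmin⟩ := hu.1.le_and_integrable hg hN hs0 hs1 hs hm
  have hu0 : u ≠ 0 := fun h => by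
    rw [(mass_eq_zero_iff u).2 h] at hmass
    exact hm.ne hmass
  -- A direction transversal to the sphere: since `∫ uφ ≠ 0`, the mass changes to first order, and
  -- correcting it by dilation brings in the Pohožaev functional.
  obtain ⟨φ, hφ⟩ := exists_schwartz_integral_ne_zero hu0
  set Φ : Hs N s := schwartzHs hs0.le hs1 φ with hΦ
  have haeq := coeFn_schwartzHs hs0.le hs1 φ
  set a : ℝ := ∫ x, (u : L2 N) x * φ x with ha
  have ha' : ∫ x, (u : L2 N) x * (Φ : L2 N) x = a := by
    refine integral_congr_ae ?_
    filter_upwards [haeq] with x hx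
    rw [hx]
  have hweak : energyForm u Φ + μ * a = ∫ x, g ((u : L2 N) x) * φ x := by
    have h := hu.2 Φ (φ.integrable.congr haeq.symm)
    rw [ha'] at h
    rw [h]
    refine integral_congr_ae ?_
    filter_upwards [haeq] with x hx
    rw [hx]
  have hq : HasDerivAt (fun t : ℝ => mass (u + t • Φ) / m) (2 * a / m) 0 := by
    have h1 := hasDerivAt_quadratic_zero (mass u) a (mass Φ)
    have : (fun t : ℝ => mass (u + t • Φ)) = fun t => mass u + 2 * t * a + t ^ 2 * mass Φ := by
      ext t
      rw [mass_add_smul, ha']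
    simp_rw [← this] at h1
    exact h1.div_const m
  have hE : HasDerivAt (fun t : ℝ => energy (u + t • Φ)) (2 * energyForm u Φ) 0 := by
    have : (fun t : ℝ => energy (u + t • Φ))
        = fun t => energy u + 2 * t * energyForm u Φ + t ^ 2 * energy Φ := by
      ext t
      rw [energy_add_smul]
    rw [this]
    exact hasDerivAt_quadratic_zero _ _ _
  have hV := hg.hasDerivAt_potentialReal hN hs0 hs1 hs hi φ
  rw [← hΦ] at hV
  have hq0 : mass (u + (0 : ℝ) • Φ) / m = 1 := by
    rw [zero_smul, add_zero, hmass, div_self hm.ne']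
  have hpow := hq.rpow_const (p := (2 * s - N) / N) (Or.inl (by rw [hq0]; exact one_ne_zero))
  have hinv := hq.inv (by rw [hq0]; exact one_ne_zero)
  -- With `q(t) = mass(u + tΦ)/m`, this differentiates `½ q^((2s-N)/N) · energy - q⁻¹ · potential`,
  -- the value of `K` after dilating `u + tΦ` to mass `m`.
  have hf := ((hpow.mul hE).const_mul (1 / 2)).sub (hinv.mul hV)
  have hloc : IsLocalMin (fun t : ℝ => 1 / 2 * ((mass (u + t • Φ) / m) ^ ((2 * s - N) / N)
      * energy (u + t • Φ)) - (mass (u + t • Φ) / m)⁻¹ * potentialReal g (u + t • Φ)) 0 := by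
    have hev : ∀ᶠ t : ℝ in 𝓝 0, 0 < mass (u + t • Φ) / m :=
      hq.continuousAt.eventually (lt_mem_nhds (one_pos.trans_eq hq0.symm))
    filter_upwards [hev] with t ht
    have htm : 0 < mass (u + t • Φ) := by
      rw [div_pos_iff_of_pos_right hm] at ht
      exact ht
    obtain ⟨w, h1, h2, h3, h4⟩ := exists_dil_mass_eq hN hm htm
      (hg.integrable_primitive_add_schwartz hN hs0 hs1 hs hi φ t)
    have h5 := hmin w h1 h2
    rw [h3, h4] at h5
    refine le_trans (le_of_eq ?_) h5
    rw [hq0, zero_smul, add_zero]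
    simp
  have hzero := hloc.hasDerivAt_eq_zero hf
  rw [Pi.inv_apply, hq0, zero_smul, add_zero] at hzero
  simp only [Real.one_rpow, one_pow, inv_one, one_mul, mul_one, div_one] at hzero
  have hNpos : (0 : ℝ) < N := by positivity
  have hd : 0 < (N : ℝ) - 2 * s := by linarith
  -- The weak equation replaces `energyForm u Φ - ∫ g(u)φ` by `-μa`. Every term of the vanishing
  -- derivative then carries the factor `a`, and what remains is `(N - 2s) P_μ(u)`.
  have key : a * (((N : ℝ) - 2 * s) * energy u + 2 * N * (μ / 2 * m - potentialReal g u)) = 0 := by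
    have h6 : energyForm u Φ - ∫ x, g ((u : L2 N) x) * φ x = -(μ * a) := by linarith
    field_simp at hzero
    linear_combination (-1 : ℝ) * hzero + N * m * h6
  have h7 := (mul_eq_zero.1 key).resolve_left hφ
  rw [critExp]
  field_simp
  linarith

/-- `J_μ` on the Pohožaev set, compared with `K` on the sphere `𝓢_m`. -/
lemma exists_mem_sphere_le_of_pohozaev (hN : 1 ≤ N) (hs0 : 0 < s) (hs : 2 * s < N) {m μ : ℝ}
    (hm : 0 < m) {v : Hs N s} (hv : v ≠ 0)
    (hi : Integrable (fun x => primitive g ((v : L2 N) x)) volume)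
    (hP : energy v + critExp N s * (μ / 2 * mass v - potentialReal g v) = 0) :
    ∃ w : Hs N s, mass w = m ∧ Integrable (fun x => primitive g ((w : L2 N) x)) volume ∧
      1 / 2 * energy w - potentialReal g w + μ / 2 * m
        ≤ 1 / 2 * energy v + μ / 2 * mass v - potentialReal g v ∧
      (mass v ≠ m → 1 / 2 * energy w - potentialReal g w + μ / 2 * m
        < 1 / 2 * energy v + μ / 2 * mass v - potentialReal g v) := by
  obtain ⟨w, h1, h2, h3, h4⟩ := exists_dil_mass_eq hN hm (mass_pos hv) hi
  have hE := energy_pos (by omega) hv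
  have hM := mass_pos hv
  have hNpos : (0 : ℝ) < N := by positivity
  have hd : 0 < (N : ℝ) - 2 * s := by linarith
  -- `α = 2 / 2^*_s`, so the Pohožaev constraint expresses the potential through mass and energy, as
  -- in `hV`.
  set α : ℝ := (N - 2 * s) / N with hα
  have hα0 : 0 < α := by positivity
  have hα1 : α < 1 := by rw [hα, div_lt_one hNpos]; linarith
  set r : ℝ := m / mass v with hr
  have hr0 : 0 < r := by positivity
  have hV : potentialReal g v = μ / 2 * mass v + α / 2 * energy v := by
    rw [critExp] at hP
    rw [hα]
    field_simp at hP ⊢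
    linarith
  have hrm : r * mass v = m := by rw [hr]; field_simp
  have hwE : energy w = r ^ α * energy v := by
    rw [h3, hr, ← inv_div m, Real.inv_rpow hr0.le, ← Real.rpow_neg hr0.le]
    congr 2
    rw [hα]
    ring
  have hwV : potentialReal g w = r * potentialReal g v := by rw [h4, inv_div]
  have hL : 1 / 2 * energy w - potentialReal g w + μ / 2 * m
      = energy v / 2 * (r ^ α - α * r) := by
    rw [hwE, hwV, hV]
    linear_combination (-(μ / 2)) * hrm
  have hR : 1 / 2 * energy v + μ / 2 * mass v - potentialReal g v
      = energy v / 2 * (1 - α) := by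
    rw [hV]
    ring
  -- Bernoulli's inequality: the concave function `r^α` lies below its tangent at `r = 1`.
  have hb : r ^ α ≤ 1 + α * (r - 1) := by
    simpa using rpow_one_add_le_one_add_mul_self (s := r - 1) (by linarith) hα0.le hα1.le
  refine ⟨w, h1, h2, ?_, fun hne => ?_⟩
  · rw [hL, hR]
    nlinarith
  · have hr1 : r ≠ 1 := fun h => hne (by rw [h, one_mul] at hrm; exact hrm)
    have hb' : r ^ α < 1 + α * (r - 1) := by
      simpa using rpow_one_add_lt_one_add_mul_self (s := r - 1) (by linarith)
        (sub_ne_zero.2 hr1) hα0 hα1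
    rw [hL, hR]
    nlinarith

/-- Each `v ∈ 𝓟_μ` dilates to some `w` of mass `m` with `J_μ(v) ≥ K(w) + μm/2 ≥ K(u) + μm/2 =
J_μ(u)`. -/
lemma IsL2MinWithMultiplier.isActionMin (hg : IsAdmissible N s g) (hN : 1 ≤ N)
    (hs0 : 0 < s) (hs1 : s ≤ 1) (hs : 2 * s < N) {m μ : ℝ} (hm : 0 < m) {u : Hs N s}
    (hu : IsL2MinWithMultiplier g m μ u) : IsActionMin g μ u := by
  obtain ⟨hmass, hi, hmin⟩ := hu.1.le_and_integrable hg hN hs0 hs1 hs hm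
  have hp := critExp_gt_two hs0 hs
  have hu0 : u ≠ 0 := fun h => by
    rw [(mass_eq_zero_iff u).2 h] at hmass
    exact hm.ne hmass
  have hmem : u ∈ pohozaevSet N s g μ := by
    refine ⟨hu0, ?_⟩
    rw [P_eq_coe hi, hmass, pohozaev_of_isL2MinWithMultiplier hg hN hs0 hs1 hs hm hu,
      EReal.coe_zero]
  refine ⟨hmem, le_antisymm (le_iInf₂ fun v hv => ?_) (iInf₂_le u hmem)⟩
  have hvi := integrable_of_P_eq_zero hg.continuous (by linarith) hv.2
  have hP := hv.2
  rw [P_eq_coe hvi] at hP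
  obtain ⟨w, h1, h2, h3, -⟩ := exists_mem_sphere_le_of_pohozaev hN hs0 hs hm hv.1 hvi
    (by exact_mod_cast hP)
  rw [J_eq_coe hi, J_eq_coe hvi, EReal.coe_le_coe_iff, hmass]
  linarith [hmin w h1 h2]

end FracNLS

end

open FracNLS
theorem proposition1p9 (N : ℕ) (hN : 2 ≤ N) (s : ℝ) (hs0 : 0 < s) (hs1 : s < 1)
    (m : ℝ) (hm : 0 < m) (g : ℝ → ℝ) (hg : IsAdmissible N s g) :
    (∀ (μ : ℝ) (u : Hs N s), IsL2MinWithMultiplier g m μ u →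
      IsActionMin g μ u ∧
      (⨅ v ∈ sphere N s m, K g v)
        = (⨅ v ∈ pohozaevSet N s g μ, J g μ v) - ((μ / 2 * m : ℝ) : EReal)) ∧
    (∀ μ : ℝ, (∃ v : Hs N s, IsL2MinWithMultiplier g m μ v) →
      ∀ u : Hs N s, IsActionMin g μ u → u ∈ sphere N s m ∧ IsL2Min g m u) := by
  have hN1 : 1 ≤ N := by omega
  have hs : 2 * s < N := by
    have : (2 : ℝ) ≤ N := by exact_mod_cast hN
    linarith
  have hp := critExp_gt_two hs0 hs
  refine ⟨fun μ u hu => ?_, ?_⟩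
  · have hact := hu.isActionMin hg hN1 hs0 hs1.le hs hm
    obtain ⟨hmass, hi, -⟩ := hu.1.le_and_integrable hg hN1 hs0 hs1.le hs hm
    refine ⟨hact, ?_⟩
    rw [← hact.2, ← hu.1.2, K_eq_coe hi, J_eq_coe hi, ← EReal.coe_sub, hmass]
    congr 1
    ring
  · rintro μ ⟨v, hv⟩ u hu
    have hact := hv.isActionMin hg hN1 hs0 hs1.le hs hm
    obtain ⟨hmass, hi, hmin⟩ := hv.1.le_and_integrable hg hN1 hs0 hs1.le hs hm
    have hui := integrable_of_P_eq_zero hg.continuous (by linarith) hu.1.2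
    have hP := hu.1.2
    rw [P_eq_coe hui] at hP
    have hJ : J g μ u = J g μ v := hu.2.trans hact.2.symm
    rw [J_eq_coe hui, J_eq_coe hi, EReal.coe_eq_coe_iff, hmass] at hJ
    obtain ⟨w, h1, h2, -, h3⟩ := exists_mem_sphere_le_of_pohozaev hN1 hs0 hs hm hu.1.1 hui
      (by exact_mod_cast hP)
    have hmu : mass u = m := by
      -- If the mass of `u` were not `m`, its dilation `w` would satisfy `K(w) + μm/2 < J_μ(u) =
      -- J_μ(v) = K(v) + μm/2`, against the minimality of `v`.
      by_contra hne
      linarith [h3 hne, hmin w h1 h2]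
    refine ⟨hmu, hmu, ?_⟩
    rw [← hv.1.2, K_eq_coe hui, K_eq_coe hi, EReal.coe_eq_coe_iff]
    rw [hmu] at hJ
    linarith
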